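/- Let $n\ge 0$ and write $\mathbf n=\{1,\dots,n\}$, $\mathbf n'=\{1',\dots,n'\}$. The Brauer monoid $\mathcal B_n$ consists of all set partitions of $\mathbf n\cup\mathbf n'$ into blocks of size $2$. To form $\alpha\beta$, place $\alpha$ on an upper and a middle row of vertices and $\beta$ on the same middle row and a lower row; two vertices of the outer rows are in the same block of $\alpha\beta$ iff they are connected in the resulting graph. A block is a transversal if it meets both $\mathbf n$ and $\mathbf n'$; the rank of $\alpha$ is its number of transversals; $\alpha^*$ is obtained by interchanging $i$ and $i'$ for all $i$. Let $P_r=\{\varepsilon\in\mathcal B_n:\varepsilon^2=\varepsilon=\varepsilon^*,\ \operatorname{rank}\varepsilon=r\}$ and $p_r=|P_r|$. A permutation $\xi$ of $\mathbf n$ is identified with the element of $\mathcal B_n$ with blocks $\{i,(i\xi)'\}$. If $\alpha$ has transversals $\{a_i,b_i'\}$ with $a_1<\dots<a_r$, then $\overline\alpha\in\mathcal B_n$ has transversals $\{i,b_i'\}$ ($1\le i\le r$), the same blocks inside $\mathbf n'$ as $\alpha$, and the remaining blocks $\{r+1,r+2\},\{r+3,r+4\},\dots,\{n-1,n\}$.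 A (right) action of a semigroup $S$ on a set $X$ is a map $X\times S\to X$, $(x,a)\mapsto xa$, with $(xa)b=x(ab)$; its degree is $|X|$; it is faithful if $xa=xb$ for all $x\in X$ implies $a=b$. The minimum transformation degree $\deg(S)$ of a finite semigroup $S$ is the least $m\ge1$ such that $S$ embeds in the monoid of self-maps of an $m$-element set, composed from left to right. **(a)** Let $n\ge4$ be even. Then $\deg(\mathcal B_n)\ge 3p_4+2p_2+p_0+1$, and every faithful action of $\mathcal B_n$ has degree at least $3p_4+2p_2+p_0+1$. More precisely, let $\zeta,\alpha,\beta,\gamma,\delta\in\mathcal B_n$ be given as follows (with dashes on the lower blocks): * $\zeta$: upper and lower blocks both $\{1,2\},\{3,4\},\{5,6\},\dots,\{n-1,n\}$; * $\alpha$: as $\zeta$, but with the upper blocks $\{1,2\},\{3,4\}$ replaced by $\{1,4\},\{2,3\}$; * $\beta$: as $\zeta$, but with the lower blocks $\{1',2'\},\{3',4'\}$ replaced by $\{1',4'\},\{2',3'\}$; * $\gamma$: transversals $\{1,1'\},\{2,2'\}$, upper and lower blocks $\{3,4\},\{5,6\},\dots,\{n-1,n\}$; * $\delta$: as $\gamma$,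 but with transversals $\{1,2'\},\{2,1'\}$. Let $C_2=\langle(1,2)\rangle$ and $C_3=\langle(1,2,3)\rangle$ be the indicated groups of permutations of $\mathbf n$. For every faithful action of $\mathcal B_n$ on a set $X$ there are $x_0,x_2,x_4\in X$ with $$x_0\zeta\ne x_0\beta,\qquad x_2\gamma\ne x_2\delta,\qquad x_4\zeta\ne x_4\alpha .$$ For every action of $\mathcal B_n$ on a set $X$ and all $x_0,x_2,x_4\in X$ satisfying these three inequalities, the sets $$Y_0=\{x_0\overline\varepsilon:\varepsilon\in P_0\},\quad Y_2=\{x_2\xi\overline\varepsilon:\xi\in C_2,\ \varepsilon\in P_2\},\quad Y_4=\{x_4\xi\overline\varepsilon:\xi\in C_3,\ \varepsilon\in P_4\}$$ have exactly $p_0$, $2p_2$ and $3p_4$ elements respectively, are pairwise disjoint, and satisfy $Y_0\cup Y_2\cup Y_4\ne X$. **(b)** Let $n\ge3$ be odd. Then $\deg(\mathcal B_n)\ge 3p_3+p_1+1$, and every faithful action of $\mathcal B_n$ has degree at least $3p_3+p_1+1$. -/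

import Mathlib

/-! ## Right actions of semigroups, faithfulness, minimum transformation degree -/

/-- A right action of a semigroup `S` on a set `X`.  (If `S` is a monoid, the identity of `S` is
not required to act as the identity map.) -/
structure RightAction (S : Type*) [Semigroup S] (X : Type*) where
  act : X → S → X
  act_mul : ∀ x a b, act (act x a) b = act x (a * b)

/-- An action is faithful if distinct elements of `S` induce distinct self-maps of `X`. -/
def RightAction.IsFaithful {S X : Type*} [Semigroup S] (μ : RightAction S X) : Prop :=
  ∀ a b : S, (∀ x, μ.act x a = μ.act x b) → a = b

/-- The point `x` witnesses that the action separates the pair `(a, b)`. -/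
def RightAction.Witnesses {S X : Type*} [Semigroup S] (μ : RightAction S X) (x : X)
    (a b : S) : Prop :=
  μ.act x a ≠ μ.act x b

/-- The minimum transformation degree of a (finite) semigroup `S`: the least `m ≥ 1` such that `S`
embeds in the monoid of all self-maps of an `m`-element set, where maps are composed from left to
right (whence the opposite of `Function.End`). -/
noncomputable def transformationDegree (S : Type*) [Semigroup S] : ℕ :=
  sInf {m : ℕ | 1 ≤ m ∧ ∃ φ : S →ₙ* (Function.End (Fin m))ᵐᵒᵖ, Function.Injective φ}

/-! ## The partition monoid -/

/-- Set partitions of `{1, …, n} ∪ {1', …, n'}`, given by their equivalence relations.  The upper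
vertices are `Sum.inl i` and the lower (dashed) vertices are `Sum.inr i`, where `i : Fin n` stands
for the vertex `i + 1`. -/
def PartitionMonoid (n : ℕ) : Type := Setoid (Fin n ⊕ Fin n)

namespace PartitionMonoid

variable {n : ℕ}

/-- `α.Rel x y` says that the vertices `x` and `y` lie in the same block of `α`. -/
def Rel (α : PartitionMonoid n) (x y : Fin n ⊕ Fin n) : Prop := Setoid.r (self := α) x y

/-- The blocks of a partition. -/
def blocks (α : PartitionMonoid n) : Set (Set (Fin n ⊕ Fin n)) := Setoid.classes α

/-- The partition whose blocks are the non-empty fibres of a labelling of the vertices. -/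
def ofLabel {L : Type*} (f : Fin n ⊕ Fin n → L) : PartitionMonoid n := Setoid.ker f

/-- Vertices of product graphs: an upper row, a middle row and a lower row. -/
abbrev Row3 (n : ℕ) : Type := Fin n ⊕ (Fin n ⊕ Fin n)

/-- Place a partition on the upper and middle rows. -/
def top : Fin n ⊕ Fin n → Row3 n := Sum.elim Sum.inl (fun i => Sum.inr (Sum.inl i))

/-- Place a partition on the middle and lower rows. -/
def bot : Fin n ⊕ Fin n → Row3 n := Sum.inr

/-- Place a partition on the upper and lower rows. -/
def outer : Fin n ⊕ Fin n → Row3 n := Sum.elim Sum.inl (fun i => Sum.inr (Sum.inr i))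

/-- The edges of the product graph of `α` and `β`. -/
inductive Edge (α β : PartitionMonoid n) : Row3 n → Row3 n → Prop
  | top {x y : Fin n ⊕ Fin n} : α.Rel x y → Edge α β (top x) (top y)
  | bot {x y : Fin n ⊕ Fin n} : β.Rel x y → Edge α β (bot x) (bot y)

/-- Being in the same connected component of the product graph. -/
def Conn (α β : PartitionMonoid n) : Row3 n → Row3 n → Prop := Relation.EqvGen (Edge α β)

/-- The product: the restriction of the connected components of the product graph to the outer
rows. -/
instance : Mul (PartitionMonoid n) :=
  ⟨fun α β => Setoid.comap outer (Relation.EqvGen.setoid (Edge α β))⟩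

/-- The identity partition, with blocks `{i, i'}`. -/
instance : One (PartitionMonoid n) := ⟨ofLabel (Sum.elim id id)⟩

/-- The reflection `α ↦ α*`, interchanging dashed and undashed vertices. -/
instance : Star (PartitionMonoid n) := ⟨fun α => Setoid.comap Sum.swap α⟩

theorem ext_rel {α β : PartitionMonoid n} (h : ∀ x y, α.Rel x y ↔ β.Rel x y) : α = β :=
  Setoid.ext h

theorem Rel.refl (α : PartitionMonoid n) (x) : α.Rel x x := Setoid.refl' α x

theorem Rel.symm {α : PartitionMonoid n} {x y} (h : α.Rel x y) : α.Rel y x := Setoid.symm' α h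

theorem Rel.trans {α : PartitionMonoid n} {x y z} (h : α.Rel x y) (h' : α.Rel y z) :
    α.Rel x z := Setoid.trans' α h h'

theorem mul_rel (α β : PartitionMonoid n) (x y) :
    (α * β).Rel x y ↔ Conn α β (outer x) (outer y) := Iff.rfl

theorem one_rel (x y : Fin n ⊕ Fin n) :
    (1 : PartitionMonoid n).Rel x y ↔ Sum.elim id id x = Sum.elim id id y := Iff.rfl

theorem ofLabel_rel {L : Type*} (f : Fin n ⊕ Fin n → L) (x y) :
    (ofLabel f).Rel x y ↔ f x = f y := Iff.rfl

theorem star_rel (α : PartitionMonoid n) (x y) :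
    (star α).Rel x y ↔ α.Rel x.swap y.swap := Iff.rfl

theorem edge_symm {α β : PartitionMonoid n} {u v} (h : Edge α β u v) : Edge α β v u := by
  cases h with
  | top h => exact .top h.symm
  | bot h => exact .bot h.symm

/-- Invariance principle for connectedness in product graphs. -/
theorem Conn.induct {α β : PartitionMonoid n} {Q : Row3 n → Prop} {u v : Row3 n}
    (h : Conn α β u v)
    (ht : ∀ x y, α.Rel x y → Q (PartitionMonoid.top x) → Q (PartitionMonoid.top y))
    (hb : ∀ x y, β.Rel x y → Q (PartitionMonoid.bot x) → Q (PartitionMonoid.bot y)) :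
    Q u → Q v := by
  have key : Q u ↔ Q v := by
    induction h with
    | rel a b h =>
      cases h with
      | top h => exact ⟨ht _ _ h, ht _ _ h.symm⟩
      | bot h => exact ⟨hb _ _ h, hb _ _ h.symm⟩
    | refl a => exact Iff.rfl
    | symm a b _ ih => exact ih.symm
    | trans a b c _ _ ih1 ih2 => exact ih1.trans ih2
  exact key.1

theorem Conn.refl {α β : PartitionMonoid n} (u) : Conn α β u u := Relation.EqvGen.refl u
theorem Conn.symm {α β : PartitionMonoid n} {u v} (h : Conn α β u v) : Conn α β v u :=
  Relation.EqvGen.symm _ _ h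
theorem Conn.trans {α β : PartitionMonoid n} {u v w} (h : Conn α β u v) (h' : Conn α β v w) :
    Conn α β u w := Relation.EqvGen.trans _ _ _ h h'
theorem Conn.top {α β : PartitionMonoid n} {x y} (h : α.Rel x y) :
    Conn α β (top x) (top y) := Relation.EqvGen.rel _ _ (.top h)
theorem Conn.bot {α β : PartitionMonoid n} {x y} (h : β.Rel x y) :
    Conn α β (bot x) (bot y) := Relation.EqvGen.rel _ _ (.bot h)

theorem rel_one_of {i : Fin n} :
    (1 : PartitionMonoid n).Rel (Sum.inl i) (Sum.inr i) := (one_rel _ _).2 rfl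

protected theorem one_mul' (α : PartitionMonoid n) : 1 * α = α := by
  apply ext_rel
  intro x y
  rw [mul_rel]
  constructor
  · intro h
    have := h.induct (Q := fun w => α.Rel x (Sum.elim Sum.inl id w)) ?_ ?_ ?_
    · rcases y with y | y <;> exact this
    · intro a b hab h
      rw [one_rel] at hab
      rcases a with a | a <;> rcases b with b | b <;> simp_all [PartitionMonoid.top]
    · intro a b hab h
      exact Rel.trans h hab
    · rcases x with x | x <;> exact Rel.refl _ _
  · intro h
    have k : ∀ z : Fin n ⊕ Fin n, Conn 1 α (outer z) (PartitionMonoid.bot z) := by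
      rintro (z | z)
      · exact Conn.top (β := α) rel_one_of
      · exact Conn.refl _
    exact (k x).trans ((Conn.bot h).trans (k y).symm)

protected theorem mul_one' (α : PartitionMonoid n) : α * 1 = α := by
  apply ext_rel
  intro x y
  rw [mul_rel]
  constructor
  · intro h
    have := h.induct (Q := fun w => α.Rel x (Sum.elim Sum.inl (Sum.elim Sum.inr Sum.inr) w)) ?_ ?_ ?_
    · rcases y with y | y <;> exact this
    · intro a b hab h
      have e : ∀ a : Fin n ⊕ Fin n,
          (Sum.elim Sum.inl (Sum.elim Sum.inr Sum.inr) (PartitionMonoid.top a)) = a := by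
        rintro (a | a) <;> rfl
      rw [e] at h ⊢
      exact Rel.trans h hab
    · intro a b hab h
      rw [one_rel] at hab
      rcases a with a | a <;> rcases b with b | b <;> simp_all [PartitionMonoid.bot]
    · rcases x with x | x <;> exact Rel.refl _ _
  · intro h
    have k : ∀ z : Fin n ⊕ Fin n, Conn α 1 (outer z) (PartitionMonoid.top z) := by
      rintro (z | z)
      · exact Conn.refl _
      · exact (Conn.bot (α := α) rel_one_of).symm
    exact (k x).trans ((Conn.top h).trans (k y).symm)

/-- Reflection of the three rows. -/
def rev : Row3 n → Row3 n :=
  Sum.elim (fun i => Sum.inr (Sum.inr i)) (Sum.elim (fun i => Sum.inr (Sum.inl i)) Sum.inl)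

theorem Conn.rev {α β : PartitionMonoid n} {u v} (h : Conn α β u v) :
    Conn (star β) (star α) (rev u) (rev v) := by
  refine h.induct (Q := fun w => Conn (star β) (star α) (PartitionMonoid.rev u)
    (PartitionMonoid.rev w)) ?_ ?_ (Conn.refl _)
  · intro x y hxy h
    have e : ∀ z : Fin n ⊕ Fin n, PartitionMonoid.rev (PartitionMonoid.top z)
        = PartitionMonoid.bot z.swap := by rintro (z | z) <;> rfl
    rw [e] at h ⊢
    exact h.trans (Conn.bot (by simpa [star_rel] using hxy))
  · intro x y hxy h
    have e : ∀ z : Fin n ⊕ Fin n, PartitionMonoid.rev (PartitionMonoid.bot z)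
        = PartitionMonoid.top z.swap := by rintro (z | z) <;> rfl
    rw [e] at h ⊢
    exact h.trans (Conn.top (by simpa [star_rel] using hxy))

theorem star_star' (α : PartitionMonoid n) : star (star α) = α := by
  apply ext_rel
  intro x y
  simp [star_rel]

theorem star_mul' (α β : PartitionMonoid n) : star (α * β) = star β * star α := by
  have e : ∀ z : Fin n ⊕ Fin n, rev (outer z) = outer z.swap := by rintro (z | z) <;> rfl
  apply ext_rel
  intro x y
  rw [star_rel, mul_rel, mul_rel]
  constructor
  · intro h
    simpa [e] using h.rev
  · intro h
    simpa [e, star_star'] using h.rev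

theorem mul_assoc_aux {α β γ : PartitionMonoid n} {x y : Fin n ⊕ Fin n}
    (h : (α * (β * γ)).Rel x y) : (α * β * γ).Rel x y := by
  rw [mul_rel] at h ⊢
  -- vertices of the second row are controlled through the product graph of `α` and `β`
  let Q : Row3 n → Prop := fun w =>
    (∃ i, w = Sum.inl i ∧ Conn (α * β) γ (outer x) (Sum.inl i)) ∨
    (∃ i, w = Sum.inr (Sum.inr i) ∧ Conn (α * β) γ (outer x) (Sum.inr (Sum.inr i))) ∨
    (∃ i, w = Sum.inr (Sum.inl i) ∧ ∃ p, Conn (α * β) γ (outer x) (PartitionMonoid.top p) ∧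
      Conn α β (outer p) (Sum.inr (Sum.inl i)))
  have hQ : Q (outer y) := by
    refine h.induct (Q := Q) ?_ ?_ ?_
    · intro a b hab ha
      have ha' : ∃ p, Conn (α * β) γ (outer x) (PartitionMonoid.top p) ∧
          Conn α β (outer p) (PartitionMonoid.top a) := by
        rcases ha with ⟨i, hi, h⟩ | ⟨i, hi, h⟩ | ⟨i, hi, h⟩
        · exact ⟨Sum.inl i, h, by rw [hi]; exact Conn.refl _⟩
        · rcases a with a | a <;> simp [PartitionMonoid.top] at hi
        · rw [hi]; exact h
      obtain ⟨p, hp, hpa⟩ := ha'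
      have hpb := hpa.trans (Conn.top hab)
      rcases b with b | b
      · exact Or.inl ⟨b, rfl, hp.trans (Conn.top (y := Sum.inl b) hpb)⟩
      · exact Or.inr (Or.inr ⟨b, rfl, p, hp, hpb⟩)
    · intro a b hab ha
      rw [mul_rel] at hab
      -- an inner invariant along the product graph of `β` and `γ`
      let T : Row3 n → Prop := fun w =>
        (∃ i, w = Sum.inr (Sum.inr i) ∧ Conn (α * β) γ (outer x) (Sum.inr (Sum.inr i))) ∨
        (∃ z, w = PartitionMonoid.top z ∧ ∃ p, Conn (α * β) γ (outer x) (PartitionMonoid.top p) ∧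
          Conn α β (outer p) (PartitionMonoid.bot z))
      have hT : T (outer b) := by
        refine hab.induct (Q := T) ?_ ?_ ?_
        · rintro c d hcd (⟨i, hi, -⟩ | ⟨z, hz, p, hp, hpz⟩)
          · rcases c with c | c <;> simp [PartitionMonoid.top] at hi
          · have : c = z := by
              rcases c with c | c <;> rcases z with z | z <;> simp [PartitionMonoid.top] at hz <;>
                simp [hz]
            subst this
            exact Or.inr ⟨d, rfl, p, hp, hpz.trans (Conn.bot hcd)⟩
        · intro c d hcd hc
          have hc' : Conn (α * β) γ (outer x) (PartitionMonoid.bot c) := by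
            rcases hc with ⟨i, hi, h⟩ | ⟨z, hz, p, hp, hpz⟩
            · rw [hi]; exact h
            · rcases c with c | c <;> rcases z with z | z <;>
                simp [PartitionMonoid.top, PartitionMonoid.bot] at hz
              subst hz
              exact hp.trans (Conn.top (y := Sum.inr c) hpz)
          have hd := hc'.trans (Conn.bot hcd)
          rcases d with d | d
          · exact Or.inr ⟨Sum.inr d, rfl, Sum.inr d, hd, Conn.refl _⟩
          · exact Or.inl ⟨d, rfl, hd⟩
        · rcases ha with ⟨i, hi, h⟩ | ⟨i, hi, h⟩ | ⟨i, hi, p, h, h'⟩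
          · simp [PartitionMonoid.bot] at hi
          · refine Or.inl ⟨i, ?_, h⟩
            simp only [PartitionMonoid.bot, Sum.inr.injEq] at hi
            subst hi; rfl
          · simp only [PartitionMonoid.bot, Sum.inr.injEq] at hi
            subst hi
            exact Or.inr ⟨Sum.inl i, rfl, p, h, h'⟩
      rcases b with b | b
      · rcases hT with ⟨i, hi, -⟩ | ⟨z, hz, p, hp, hpz⟩
        · simp [outer] at hi
        · rcases z with z | z <;> simp [PartitionMonoid.top, outer] at hz
          subst hz
          exact Or.inr (Or.inr ⟨b, rfl, p, hp, hpz⟩)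
      · rcases hT with ⟨i, hi, h⟩ | ⟨z, hz, p, hp, hpz⟩
        · exact Or.inr (Or.inl ⟨i, hi, h⟩)
        · rcases z with z | z <;> simp [PartitionMonoid.top, outer] at hz
    · rcases x with x | x
      · exact Or.inl ⟨x, rfl, Conn.refl _⟩
      · exact Or.inr (Or.inl ⟨x, rfl, Conn.refl _⟩)
  rcases hQ with ⟨i, hi, h⟩ | ⟨i, hi, h⟩ | ⟨i, hi, -⟩
  · rw [hi]; exact h
  · rw [hi]; exact h
  · rcases y with y | y <;> simp [outer] at hi

instance : Monoid (PartitionMonoid n) where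
  mul_assoc α β γ := by
    apply ext_rel
    intro x y
    refine ⟨fun h => ?_, mul_assoc_aux⟩
    have h' : (star γ * (star β * star α)).Rel x.swap y.swap := by
      rw [← star_mul', ← star_mul', star_rel]
      simpa using h
    have h'' := mul_assoc_aux h'
    rw [← star_mul', ← star_mul', star_rel] at h''
    simpa using h''
  one_mul := PartitionMonoid.one_mul'
  mul_one := PartitionMonoid.mul_one'

/-- The transversals: the blocks that contain both dashed and undashed vertices. -/
def transversals (α : PartitionMonoid n) : Set (Set (Fin n ⊕ Fin n)) :=
  {B ∈ α.blocks | (∃ i, Sum.inl i ∈ B) ∧ ∃ j, Sum.inr j ∈ B}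

/-- The rank: the number of transversals. -/
noncomputable def rank (α : PartitionMonoid n) : ℕ := α.transversals.ncard

open Classical in
/-- The domain: the set of upper vertices that lie in transversals. -/
noncomputable def dom (α : PartitionMonoid n) : Finset (Fin n) :=
  {i : Fin n | ∃ j : Fin n, α.Rel (Sum.inl i) (Sum.inr j)}

/-- Every block has size two. -/
def IsBrauer (α : PartitionMonoid n) : Prop := ∀ B ∈ α.blocks, B.ncard = 2

theorem isBrauer_iff {α : PartitionMonoid n} :
    α.IsBrauer ↔ ∀ x, ∃ y, y ≠ x ∧ ∀ z, α.Rel z x ↔ z = x ∨ z = y := by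
  have e : α.IsBrauer ↔ ∀ x, {z | α.Rel z x}.ncard = 2 := by
    constructor
    · intro h x
      exact h _ ⟨x, rfl⟩
    · rintro h _ ⟨x, rfl⟩
      exact h x
  rw [e]
  refine forall_congr' fun x => ?_
  constructor
  · intro h
    obtain ⟨a, b, hab, hs⟩ := Set.ncard_eq_two.1 h
    have hx : x ∈ {z | α.Rel z x} := Rel.refl _ _
    rw [hs] at hx
    rcases hx with rfl | hx
    · exact ⟨b, hab.symm, fun z => by
        change z ∈ {z | α.Rel z x} ↔ _
        rw [hs]; simp⟩
    · rw [Set.mem_singleton_iff] at hx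
      subst hx
      exact ⟨a, hab, fun z => by
        change z ∈ {z | α.Rel z x} ↔ _
        rw [hs]; simp [or_comm]⟩
  · rintro ⟨y, hy, h⟩
    rw [Set.ncard_eq_two]
    exact ⟨x, y, hy.symm, by ext z; simpa using h z⟩

theorem IsBrauer.exists_partner {α : PartitionMonoid n} (h : α.IsBrauer) :
    ∃ f : Fin n ⊕ Fin n → Fin n ⊕ Fin n, (∀ x, f x ≠ x) ∧ (∀ x, f (f x) = x) ∧
      ∀ x z, α.Rel z x ↔ z = x ∨ z = f x := by
  rw [isBrauer_iff] at h
  choose f hf hr using h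
  refine ⟨f, hf, fun x => ?_, hr⟩
  have h1 : α.Rel (f x) x := (hr x _).2 (Or.inr rfl)
  rcases (hr (f x) x).1 h1.symm with h2 | h2
  · exact absurd h2.symm (hf x)
  · exact h2.symm

/-- Two involutions of a finite set without common fixed point: the component of a fixed point of
the second one contains exactly one further fixed point. -/
theorem two_fixed_points {V : Type*} [Finite V] (F G : Equiv.Perm V)
    (hF : ∀ v, F (F v) = v) (hG : ∀ v, G (G v) = v) (hFG : ∀ v, F v = v → G v ≠ v)
    (x : V) (hx : G x = x) :
    ∃ y, y ≠ x ∧ ∀ z, (Relation.EqvGen (fun u v => v = F u ∨ v = G u) x z ∧ (F z = z ∨ G z = z)) ↔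
      z = x ∨ z = y := by
  set p : Equiv.Perm V := G * F with hp
  have hFF : F * F = 1 := by ext v; simp [hF]
  have hGG : G * G = 1 := by ext v; simp [hG]
  have hFi : F⁻¹ = F := inv_eq_of_mul_eq_one_left hFF
  have hGi : G⁻¹ = G := inv_eq_of_mul_eq_one_left hGG
  have hGp : ∀ k : ℤ, G ((p ^ k) x) = (p ^ (-k)) x := by
    intro k
    have h1 : G * p ^ k * G⁻¹ = (G * p * G⁻¹) ^ k := (conj_zpow).symm
    have h2 : G * p * G⁻¹ = p⁻¹ := by
      rw [hp, mul_inv_rev, hGi, hFi, ← mul_assoc, hGG, one_mul]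
    rw [h2, inv_zpow, hGi] at h1
    have h3 := congrArg (fun q : Equiv.Perm V => q x) h1
    simpa [hx, zpow_neg] using h3
  have hFp : ∀ k : ℤ, F ((p ^ k) x) = (p ^ (-(k + 1))) x := by
    intro k
    rw [← hGp (k + 1)]
    have : p ^ (k + 1) = p * p ^ k := by rw [add_comm, zpow_add, zpow_one]
    rw [this, hp]
    simp [hG]
  have hcomp : ∀ z, Relation.EqvGen (fun u v => v = F u ∨ v = G u) x z ↔
      ∃ k : ℤ, z = (p ^ k) x := by
    intro z
    constructor
    · intro h
      have key : ∀ u v, Relation.EqvGen (fun u v => v = F u ∨ v = G u) u v →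
          ((∃ k : ℤ, u = (p ^ k) x) ↔ ∃ k : ℤ, v = (p ^ k) x) := by
        intro u v h
        induction h with
        | rel a b h =>
          constructor
          · rintro ⟨k, rfl⟩
            rcases h with rfl | rfl
            · exact ⟨_, hFp k⟩
            · exact ⟨_, hGp k⟩
          · rintro ⟨k, hk⟩
            rcases h with rfl | rfl
            · refine ⟨-(k + 1), ?_⟩
              rw [← hFp, ← hk, hF]
            · refine ⟨-k, ?_⟩
              rw [← hGp, ← hk, hG]
        | refl a => exact Iff.rfl
        | symm a b _ ih => exact ih.symm
        | trans a b c _ _ ih1 ih2 => exact ih1.trans ih2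
      exact (key x z h).1 ⟨0, by simp⟩
    · rintro ⟨k, rfl⟩
      have step : ∀ u, Relation.EqvGen (fun u v => v = F u ∨ v = G u) u (p u) := fun u =>
        .trans _ (F u) _ (.rel _ _ (Or.inl rfl)) (.rel _ _ (Or.inr rfl))
      induction k using Int.induction_on with
      | zero => exact .refl _
      | succ i ih =>
        refine .trans _ _ _ ih ?_
        rw [add_comm, zpow_add, zpow_one]
        exact step _
      | pred i ih =>
        refine .trans _ _ _ ih (.symm _ _ ?_)
        have : p ^ (-(i : ℤ)) = p * p ^ (-(i : ℤ) - 1) := by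
          rw [← zpow_one_add]; congr 1; ring
        rw [this]
        exact step _
  set m := Function.minimalPeriod (p • ·) x with hm
  have hper : ∀ k l : ℤ, (p ^ k) x = (p ^ l) x ↔ (m : ℤ) ∣ k - l := by
    intro k l
    have h0 := MulAction.zpow_smul_eq_iff_minimalPeriod_dvd (a := p) (b := x) (n := k - l)
    rw [hm, ← h0, Equiv.Perm.smul_def]
    constructor
    · intro h
      rw [sub_eq_neg_add, zpow_add, Equiv.Perm.mul_apply, h, ← Equiv.Perm.mul_apply, ← zpow_add]
      simp
    · intro h
      have : p ^ k = p ^ l * p ^ (k - l) := by rw [← zpow_add]; congr 1; ring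
      rw [this, Equiv.Perm.mul_apply, h]
  have hmpos : 0 < m := by
    have := isOfFinOrder_of_finite p
    obtain ⟨k, hk, h⟩ := this.exists_pow_eq_one
    refine Function.minimalPeriod_pos_of_mem_periodicPts ⟨k, hk, ?_⟩
    change ((p • ·)^[k]) x = x
    rw [smul_iterate, h]
    simp
  have hFix : ∀ k : ℤ, F ((p ^ k) x) = (p ^ k) x ↔ (m : ℤ) ∣ 2 * k + 1 := by
    intro k
    rw [hFp, eq_comm, hper]
    ring_nf
  have hGix : ∀ k : ℤ, G ((p ^ k) x) = (p ^ k) x ↔ (m : ℤ) ∣ 2 * k := by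
    intro k
    rw [hGp, eq_comm, hper]
    ring_nf
  have hm1 : m ≠ 1 := by
    intro h1
    have := (hFix 0).2 (by simp [h1])
    exact hFG x (by simpa using this) hx
  have h0 : x = (p ^ (0 : ℤ)) x := by simp
  refine ⟨(p ^ ((m / 2 : ℕ) : ℤ)) x, ?_, ?_⟩
  · intro h
    have h' := (hper (m / 2 : ℕ) 0).1 (by simpa using h)
    rw [sub_zero, Int.natCast_dvd_natCast] at h'
    have := Nat.le_of_dvd (by omega) h'
    omega
  · intro z
    rw [hcomp]
    constructor
    · rintro ⟨⟨k, rfl⟩, h⟩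
      rw [hFix, hGix] at h
      have : (m : ℤ) ∣ k - 0 ∨ (m : ℤ) ∣ k - (m / 2 : ℕ) := by
        rcases Nat.even_or_odd' m with ⟨j, hj | hj⟩
        · have hj2 : m / 2 = j := by omega
          rw [hj2, hj]
          push_cast
          rcases h with ⟨t, ht⟩ | ⟨t, ht⟩
          · rw [hj] at ht; push_cast at ht
            have : 2 * (j * t - k) = 1 := by linarith
            omega
          · rw [hj] at ht; push_cast at ht
            have hk : k = j * t := by linarith
            rcases Int.even_or_odd' t with ⟨s, hs | hs⟩
            · left; exact ⟨s, by rw [hk, hs]; ring⟩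
            · right; exact ⟨s, by rw [hk, hs]; ring⟩
        · have hj2 : m / 2 = j := by omega
          have hcop : IsCoprime (m : ℤ) 2 := by
            rw [hj]; push_cast; exact ⟨1, -j, by ring⟩
          rw [hj2]
          rcases h with h | h
          · right
            refine hcop.dvd_of_dvd_mul_left ?_
            have : (2 : ℤ) * (k - j) = (2 * k + 1) - m := by rw [hj]; push_cast; ring
            rw [this]
            exact dvd_sub h dvd_rfl
          · left
            rw [sub_zero]
            exact hcop.dvd_of_dvd_mul_left h
      rcases this with h | h
      · left; simpa using (hper _ _).2 h
      · right; exact (hper _ _).2 h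
    · rintro (rfl | rfl)
      · exact ⟨⟨0, by simp⟩, Or.inr hx⟩
      · refine ⟨⟨_, rfl⟩, ?_⟩
        rw [hFix, hGix]
        rcases Nat.even_or_odd' m with ⟨j, hj | hj⟩
        · right; exact ⟨1, by push_cast; omega⟩
        · left; exact ⟨1, by push_cast; omega⟩

theorem IsBrauer.mul {α β : PartitionMonoid n} (hα : α.IsBrauer) (hβ : β.IsBrauer) :
    (α * β).IsBrauer := by
  obtain ⟨f, hf, hff, hfr⟩ := hα.exists_partner
  obtain ⟨g, hg, hgg, hgr⟩ := hβ.exists_partner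
  let F0 : Row3 n → Row3 n := Sum.elim (fun i => PartitionMonoid.top (f (Sum.inl i)))
    (Sum.elim (fun i => PartitionMonoid.top (f (Sum.inr i))) (fun i => Sum.inr (Sum.inr i)))
  let G0 : Row3 n → Row3 n := Sum.elim Sum.inl (fun z => PartitionMonoid.bot (g z))
  have hFt : ∀ z, F0 (PartitionMonoid.top z) = PartitionMonoid.top (f z) := by
    rintro (z | z) <;> rfl
  have hGb : ∀ z, G0 (PartitionMonoid.bot z) = PartitionMonoid.bot (g z) := fun z => rfl
  have hF : Function.Involutive F0 := by
    rintro (i | i | i)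
    · change F0 (PartitionMonoid.top (f _)) = _
      rw [hFt, hff]; rfl
    · change F0 (PartitionMonoid.top (f _)) = _
      rw [hFt, hff]; rfl
    · rfl
  have hG : Function.Involutive G0 := by
    rintro (i | z)
    · rfl
    · change G0 (PartitionMonoid.bot (g z)) = _
      rw [hGb, hgg]; rfl
  have topinj : Function.Injective (PartitionMonoid.top (n := n)) := by
    rintro (a | a) (b | b) h <;> simp_all [PartitionMonoid.top]
  have hFfix : ∀ v, F0 v = v ↔ ∃ i, v = Sum.inr (Sum.inr i) := by
    rintro (i | i | i)
    · simp only [reduceCtorEq, exists_false, iff_false]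
      intro h
      exact hf _ (topinj h)
    · simp only [Sum.inr.injEq, reduceCtorEq, exists_false, iff_false]
      intro h
      exact hf _ (topinj (a₂ := Sum.inr i) h)
    · simp [F0]
  have hGfix : ∀ v, G0 v = v ↔ ∃ i, v = Sum.inl i := by
    rintro (i | z)
    · simp [G0]
    · simp only [reduceCtorEq, exists_false, iff_false]
      intro h
      exact hg z (Sum.inr.inj h)
  have hconn : ∀ u v, Conn α β u v ↔ Relation.EqvGen (fun u v => v = F0 u ∨ v = G0 u) u v := by
    intro u v
    constructor
    · intro h
      refine h.induct (Q := fun w => Relation.EqvGen (fun u v => v = F0 u ∨ v = G0 u) u w)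
        ?_ ?_ (.refl _)
      · intro x y hxy h
        rcases (hfr x y).1 hxy.symm with rfl | rfl
        · exact h
        · exact .trans _ _ _ h (.rel _ _ (Or.inl (hFt x).symm))
      · intro x y hxy h
        rcases (hgr x y).1 hxy.symm with rfl | rfl
        · exact h
        · exact .trans _ _ _ h (.rel _ _ (Or.inr (hGb x).symm))
    · intro h
      induction h with
      | rel a b h =>
        rcases h with rfl | rfl
        · rcases a with i | i | i
          · exact Conn.top (((hfr (Sum.inl i) _).2 (Or.inr rfl)).symm)
          · exact Conn.top (x := Sum.inr i) (((hfr (Sum.inr i) _).2 (Or.inr rfl)).symm)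
          · exact Conn.refl _
        · rcases a with i | z
          · exact Conn.refl _
          · exact Conn.bot (((hgr z _).2 (Or.inr rfl)).symm)
      | refl a => exact Conn.refl _
      | symm a b _ ih => exact ih.symm
      | trans a b c _ _ ih1 ih2 => exact ih1.trans ih2
  have houter : ∀ v, (F0 v = v ∨ G0 v = v) ↔ ∃ x, v = outer x := by
    intro v
    rw [hFfix, hGfix]
    constructor
    · rintro (⟨i, rfl⟩ | ⟨i, rfl⟩)
      · exact ⟨Sum.inr i, rfl⟩
      · exact ⟨Sum.inl i, rfl⟩
    · rintro ⟨i | i, rfl⟩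
      · exact Or.inr ⟨i, rfl⟩
      · exact Or.inl ⟨i, rfl⟩
  have outinj : Function.Injective (outer (n := n)) := by
    rintro (a | a) (b | b) h <;> simp_all [outer]
  have hno : ∀ v, F0 v = v → G0 v ≠ v := by
    intro v h1 h2
    obtain ⟨i, rfl⟩ := (hFfix v).1 h1
    obtain ⟨j, hj⟩ := (hGfix _).1 h2
    simp at hj
  rw [isBrauer_iff]
  intro x
  have main : ∃ y, y ≠ outer x ∧ ∀ z, (Relation.EqvGen (fun u v => v = F0 u ∨ v = G0 u) (outer x) z
      ∧ (F0 z = z ∨ G0 z = z)) ↔ z = outer x ∨ z = y := by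
    rcases (houter (outer x)).2 ⟨x, rfl⟩ with h | h
    · have := two_fixed_points hG.toPerm hF.toPerm hG hF
        (fun v h1 h2 => hno v h2 h1) (outer x) h
      simpa only [Function.Involutive.coe_toPerm, or_comm] using this
    · exact two_fixed_points hF.toPerm hG.toPerm hF hG hno (outer x) h
  obtain ⟨y, hy, h⟩ := main
  obtain ⟨y', rfl⟩ := (houter y).1 ((h y).2 (Or.inr rfl)).2
  refine ⟨y', fun e => hy (by rw [e]), fun z => ?_⟩
  have hz := h (outer z)
  rw [outinj.eq_iff, outinj.eq_iff] at hz
  rw [← hz, mul_rel, ← hconn]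
  exact ⟨fun k => ⟨k.symm, (houter _).2 ⟨z, rfl⟩⟩, fun k => k.1.symm⟩

/-- The partition with blocks `{i, (i σ)'}` given by a permutation `σ`. -/
def ofPerm (σ : Equiv.Perm (Fin n)) : PartitionMonoid n := ofLabel (Sum.elim σ id)

theorem isBrauer_ofPerm (σ : Equiv.Perm (Fin n)) : (ofPerm σ).IsBrauer := by
  rw [isBrauer_iff]
  rintro (i | i)
  · refine ⟨Sum.inr (σ i), by simp, ?_⟩
    rintro (j | j) <;> simp [ofPerm, ofLabel_rel]
  · refine ⟨Sum.inl (σ.symm i), by simp, ?_⟩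
    rintro (j | j) <;> simp [ofPerm, ofLabel_rel, Equiv.eq_symm_apply]

theorem IsBrauer.star {α : PartitionMonoid n} (h : α.IsBrauer) : (star α).IsBrauer := by
  rw [isBrauer_iff] at h ⊢
  intro x
  obtain ⟨y, hy, hr⟩ := h x.swap
  have e : ∀ a b : Fin n ⊕ Fin n, a.swap = b ↔ a = b.swap := by
    rintro (a | a) (b | b) <;> simp
  refine ⟨y.swap, fun h => hy ((e y x).1 h), fun z => ?_⟩
  rw [star_rel, hr, e, e, Sum.swap_swap]

/-- The partition with upper blocks the fibres of `u`, lower blocks the fibres of `l`, and no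
transversals. -/
def upperLower (u l : Fin n → ℕ) : PartitionMonoid n :=
  ofLabel (Sum.elim (fun i => (Sum.inl (u i) : ℕ ⊕ ℕ)) (fun j => Sum.inr (l j)))

theorem isBrauer_upperLower {u l : Fin n → ℕ}
    (hu : ∀ i, ∃ j, j ≠ i ∧ ∀ k, u k = u i ↔ k = i ∨ k = j)
    (hl : ∀ i, ∃ j, j ≠ i ∧ ∀ k, l k = l i ↔ k = i ∨ k = j) : (upperLower u l).IsBrauer := by
  rw [isBrauer_iff]
  rintro (i | i)
  · obtain ⟨j, hj, h⟩ := hu i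
    refine ⟨Sum.inl j, by simpa using hj, ?_⟩
    rintro (k | k) <;> simp [upperLower, ofLabel_rel, h]
  · obtain ⟨j, hj, h⟩ := hl i
    refine ⟨Sum.inr j, by simpa using hj, ?_⟩
    rintro (k | k) <;> simp [upperLower, ofLabel_rel, h]

/-- The labelling with fibres `{1, 2}, {3, 4}, {5, 6}, …`. -/
def nested0 (i : Fin n) : ℕ := i.val / 2

/-- The labelling with fibres `{1, 4}, {2, 3}, {5, 6}, …`. -/
def nested1 (i : Fin n) : ℕ :=
  if i.val = 0 ∨ i.val = 3 then 0 else if i.val = 1 ∨ i.val = 2 then 1 else i.val / 2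

theorem nested0_pairing (he : Even n) (i : Fin n) :
    ∃ j, j ≠ i ∧ ∀ k : Fin n, nested0 k = nested0 i ↔ k = i ∨ k = j := by
  obtain ⟨m, hm⟩ := he
  have hi := i.isLt
  refine ⟨⟨if i.val % 2 = 0 then i.val + 1 else i.val - 1, by split_ifs <;> omega⟩, ?_, ?_⟩
  · rw [Ne, Fin.ext_iff]
    dsimp only
    split_ifs <;> omega
  · intro k
    rw [Fin.ext_iff, Fin.ext_iff]
    simp only [nested0]
    split_ifs <;> omega

theorem nested1_pairing (h4 : 4 ≤ n) (he : Even n) (i : Fin n) :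
    ∃ j, j ≠ i ∧ ∀ k : Fin n, nested1 k = nested1 i ↔ k = i ∨ k = j := by
  obtain ⟨m, hm⟩ := he
  have hi := i.isLt
  refine ⟨⟨if i.val < 4 then 3 - i.val else
    if i.val % 2 = 0 then i.val + 1 else i.val - 1, by split_ifs <;> omega⟩, ?_, ?_⟩
  · rw [Ne, Fin.ext_iff]
    dsimp only
    split_ifs <;> omega
  · intro k
    rw [Fin.ext_iff, Fin.ext_iff]
    simp only [nested1]
    split_ifs <;> first | omega | (simp only [false_iff]; omega)

/-- The partition whose transversals are `{i, (s i)'}` for the two indices `i = 0, 1` (standing for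
the vertices `1` and `2`), with upper blocks `{3, 4}, {5, 6}, …` and lower blocks
`{3', 4'}, {5', 6'}, …`. -/
def twoLines (s : ℕ → ℕ) : PartitionMonoid n :=
  ofLabel (Sum.elim
    (fun i => if i.val < 2 then (0, s i.val) else (1, i.val / 2))
    (fun j => if j.val < 2 then ((0, j.val) : ℕ × ℕ) else (2, j.val / 2)))

set_option linter.unusedSimpArgs false in
theorem isBrauer_twoLines (h4 : 4 ≤ n) (he : Even n) {s : ℕ → ℕ} (hs : ∀ i < 2, s i < 2)
    (hss : ∀ i < 2, s (s i) = i) : (twoLines (n := n) s).IsBrauer := by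
  obtain ⟨m, hm⟩ := he
  have hinj : ∀ i < 2, ∀ j < 2, s i = s j → i = j := fun i hi j hj h => by
    rw [← hss i hi, ← hss j hj, h]
  have huu : ∀ i k : Fin n, (twoLines (n := n) s).Rel (Sum.inl i) (Sum.inl k) ↔
      i.val = k.val ∨ (2 ≤ i.val ∧ 2 ≤ k.val ∧ i.val / 2 = k.val / 2) := by
    intro i k
    simp only [twoLines, ofLabel_rel, Sum.elim_inl]
    by_cases hi : i.val < 2 <;> by_cases hk : k.val < 2
    · have h3 := hinj i.val hi k.val hk
      have h4 : i.val = k.val → s i.val = s k.val := fun e => by rw [e]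
      rw [if_pos hi, if_pos hk, Prod.mk.injEq]
      omega
    · rw [if_pos hi, if_neg hk, Prod.mk.injEq]; omega
    · rw [if_neg hi, if_pos hk, Prod.mk.injEq]; omega
    · rw [if_neg hi, if_neg hk, Prod.mk.injEq]; omega
  have hll : ∀ i k : Fin n, (twoLines (n := n) s).Rel (Sum.inr i) (Sum.inr k) ↔
      i.val = k.val ∨ (2 ≤ i.val ∧ 2 ≤ k.val ∧ i.val / 2 = k.val / 2) := by
    intro i k
    simp only [twoLines, ofLabel_rel, Sum.elim_inr]
    by_cases hi : i.val < 2 <;> by_cases hk : k.val < 2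
    · rw [if_pos hi, if_pos hk, Prod.mk.injEq]; omega
    · rw [if_pos hi, if_neg hk, Prod.mk.injEq]; omega
    · rw [if_neg hi, if_pos hk, Prod.mk.injEq]; omega
    · rw [if_neg hi, if_neg hk, Prod.mk.injEq]; omega
  have hul : ∀ i k : Fin n, (twoLines (n := n) s).Rel (Sum.inl i) (Sum.inr k) ↔
      i.val < 2 ∧ k.val < 2 ∧ s i.val = k.val := by
    intro i k
    simp only [twoLines, ofLabel_rel, Sum.elim_inl, Sum.elim_inr]
    by_cases hi : i.val < 2 <;> by_cases hk : k.val < 2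
    · rw [if_pos hi, if_pos hk, Prod.mk.injEq]; omega
    · rw [if_pos hi, if_neg hk, Prod.mk.injEq]; omega
    · rw [if_neg hi, if_pos hk, Prod.mk.injEq]; omega
    · rw [if_neg hi, if_neg hk, Prod.mk.injEq]; omega
  have hlu : ∀ i k : Fin n, (twoLines (n := n) s).Rel (Sum.inr i) (Sum.inl k) ↔
      i.val < 2 ∧ k.val < 2 ∧ s k.val = i.val := by
    intro i k
    rw [show (twoLines (n := n) s).Rel (Sum.inr i) (Sum.inl k) ↔
      (twoLines (n := n) s).Rel (Sum.inl k) (Sum.inr i) from ⟨Rel.symm, Rel.symm⟩, hul]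
    tauto
  rw [isBrauer_iff]
  rintro (i | i) <;> have hi := i.isLt <;> by_cases h : i.val < 2
  · have h' := hs _ h
    refine ⟨Sum.inr ⟨s i.val, by omega⟩, by simp, ?_⟩
    rintro (k | k)
    · rw [huu, Sum.inl.injEq, Fin.ext_iff]; simp only [reduceCtorEq, or_false, false_or, or_self, iff_false]; omega
    · rw [hlu, Sum.inr.injEq, Fin.ext_iff]; simp only [reduceCtorEq, or_false, false_or, or_self, iff_false]; omega
  · refine ⟨Sum.inl ⟨if i.val % 2 = 0 then i.val + 1 else i.val - 1, by split_ifs <;> omega⟩,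
      ?_, ?_⟩
    · rw [Ne, Sum.inl.injEq, Fin.ext_iff]
      dsimp only
      split_ifs <;> omega
    · rintro (k | k)
      · rw [huu, Sum.inl.injEq, Sum.inl.injEq, Fin.ext_iff, Fin.ext_iff]
        dsimp only
        split_ifs <;> omega
      · rw [hlu]; simp only [reduceCtorEq, or_false, false_or, or_self, iff_false]; omega
  · have h' := hs _ h
    have h'' := hss _ h
    refine ⟨Sum.inl ⟨s i.val, by omega⟩, by simp, ?_⟩
    rintro (k | k)
    · have e : k.val < 2 → (s k.val = i.val ↔ k.val = s i.val) := fun hk =>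
        ⟨fun e => by rw [← e, hss _ hk], fun e => by rw [e, h'']⟩
      rw [hul, Sum.inl.injEq, Fin.ext_iff]; simp only [reduceCtorEq, or_false, false_or, or_self, iff_false]; omega
    · rw [hll, Sum.inr.injEq, Fin.ext_iff]; simp only [reduceCtorEq, or_false, false_or, or_self, iff_false]; omega
  · refine ⟨Sum.inr ⟨if i.val % 2 = 0 then i.val + 1 else i.val - 1, by split_ifs <;> omega⟩,
      ?_, ?_⟩
    · rw [Ne, Sum.inr.injEq, Fin.ext_iff]
      dsimp only
      split_ifs <;> omega
    · rintro (k | k)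
      · rw [hul]; simp only [reduceCtorEq, or_false, false_or, or_self, iff_false]; omega
      · rw [hll, Sum.inr.injEq, Sum.inr.injEq, Fin.ext_iff, Fin.ext_iff]
        dsimp only
        split_ifs <;> omega

/-- The block of a vertex. -/
def block (α : PartitionMonoid n) (x : Fin n ⊕ Fin n) : Set (Fin n ⊕ Fin n) := {y | α.Rel y x}

theorem block_eq {α : PartitionMonoid n} {x y} : α.block x = α.block y ↔ α.Rel x y := by
  constructor
  · intro h
    have : x ∈ α.block x := Rel.refl _ _
    rw [h] at this
    exact this
  · intro h
    ext z
    exact ⟨fun k => Rel.trans k h, fun k => Rel.trans k h.symm⟩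

/-- Let `a₁ < ⋯ < aᵣ` be the elements of the domain of `α`.  The partition `overline α` is obtained
from `α` by keeping the lower row, replacing the upper end `aᵢ` of each transversal by `i`, and
taking `{r + 1, r + 2}, {r + 3, r + 4}, …` as the remaining upper blocks. -/
noncomputable def overline (α : PartitionMonoid n) : PartitionMonoid n :=
  ofLabel (Sum.elim
    (fun i => if h : i.val < α.dom.card
      then Sum.inl (α.block (Sum.inl (α.dom.orderEmbOfFin rfl ⟨i.val, h⟩)))
      else Sum.inr ((i.val - α.dom.card) / 2))
    (fun j => (Sum.inl (α.block (Sum.inr j)) : Set (Fin n ⊕ Fin n) ⊕ ℕ)))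

theorem mem_dom {α : PartitionMonoid n} {i : Fin n} :
    i ∈ α.dom ↔ ∃ j : Fin n, α.Rel (Sum.inl i) (Sum.inr j) := by
  classical
  simp [dom]

theorem IsBrauer.even_card_dom {α : PartitionMonoid n} (hα : α.IsBrauer) :
    Even (n - α.dom.card) := by
  obtain ⟨f, hf, hff, hr⟩ := hα.exists_partner
  have hc : (α.domᶜ).card = n - α.dom.card := by rw [Finset.card_compl, Fintype.card_fin]
  rw [← hc]
  have key : ∀ i ∈ α.domᶜ, ∃ j ∈ α.domᶜ, f (Sum.inl i) = Sum.inl j := by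
    intro i hi
    rw [Finset.mem_compl, mem_dom] at hi
    rcases h : f (Sum.inl i) with j | j
    · refine ⟨j, ?_, rfl⟩
      rw [Finset.mem_compl, mem_dom]
      rintro ⟨k, hk⟩
      exact hi ⟨k, ((hr _ _).2 (Or.inr h.symm)).symm.trans hk⟩
    · exact absurd ⟨j, ((hr _ _).2 (Or.inr h.symm)).symm⟩ hi
  choose! g hg hfg using key
  have h2 : ((α.domᶜ).card : ZMod 2) = 0 := by
    rw [Finset.cast_card]
    refine Finset.sum_involution (fun i _ => g i) (fun i hi => by decide) ?_ ?_ ?_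
    · intro i hi _ e
      exact hf (Sum.inl i) (by rw [hfg i hi, e])
    · intro i hi
      exact hg i hi
    · intro i hi
      have := hfg _ (hg i hi)
      rw [← hfg i hi, hff] at this
      exact (Sum.inl.inj this).symm
  exact (ZMod.natCast_eq_zero_iff_even).1 h2

theorem IsBrauer.overline {α : PartitionMonoid n} (hα : α.IsBrauer) : α.overline.IsBrauer := by
  obtain ⟨m, hm⟩ := hα.even_card_dom
  obtain ⟨f, hf, hff, hr⟩ := hα.exists_partner
  have hle : α.dom.card ≤ n := by simpa using α.dom.card_le_univ
  set r := α.dom.card with hrr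
  -- the transversals of `α`, listed by their upper ends
  set a : Fin r → Fin n := fun i => α.dom.orderEmbOfFin rfl i with ha
  have ainj : Function.Injective a := (α.dom.orderEmbOfFin rfl).injective
  have amem : ∀ i, a i ∈ α.dom := fun i => Finset.orderEmbOfFin_mem _ _ _
  have asurj : ∀ x ∈ α.dom, ∃ i, a i = x := by
    intro x hx
    have := Finset.range_orderEmbOfFin α.dom rfl
    have hx' : x ∈ Set.range (α.dom.orderEmbOfFin rfl) := by rw [this]; exact hx
    exact hx'
  have hll : ∀ j k : Fin n, α.overline.Rel (Sum.inr j) (Sum.inr k) ↔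
      α.Rel (Sum.inr j) (Sum.inr k) := by
    intro j k
    simp [PartitionMonoid.overline, ofLabel_rel, block_eq]
  have hul : ∀ (i : Fin n) (h : i.val < r) (k : Fin n), α.overline.Rel (Sum.inl i) (Sum.inr k) ↔
      α.Rel (Sum.inl (a ⟨i, h⟩)) (Sum.inr k) := by
    intro i h k
    simp only [PartitionMonoid.overline, ofLabel_rel, Sum.elim_inl, Sum.elim_inr]
    rw [dif_pos h, Sum.inl.injEq, block_eq]
  have hul' : ∀ (i : Fin n) (_ : ¬ i.val < r) (k : Fin n),
      ¬ α.overline.Rel (Sum.inl i) (Sum.inr k) := by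
    intro i h k
    simp only [PartitionMonoid.overline, ofLabel_rel, Sum.elim_inl, Sum.elim_inr]
    rw [dif_neg h]
    simp
  have huu : ∀ (i j : Fin n) (h : i.val < r) (h' : j.val < r),
      α.overline.Rel (Sum.inl i) (Sum.inl j) ↔ i = j := by
    intro i j h h'
    simp only [PartitionMonoid.overline, ofLabel_rel, Sum.elim_inl]
    rw [dif_pos h, dif_pos h', Sum.inl.injEq, block_eq]
    constructor
    · intro e
      change α.Rel (Sum.inl (a ⟨i, h⟩)) (Sum.inl (a ⟨j, h'⟩)) at e
      obtain ⟨k, hk⟩ := mem_dom.1 (amem ⟨j, h'⟩)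
      have hk1 := (hr _ _).1 hk.symm
      have hk2 := (hr _ _).1 e
      rw [or_iff_right (by simp)] at hk1
      rw [← hk1, or_iff_left (by simp), Sum.inl.injEq] at hk2
      have := ainj hk2
      simpa [Fin.ext_iff] using this
    · rintro rfl
      exact Rel.refl _ _
  have huv : ∀ (i j : Fin n) (_ : ¬ i.val < r),
      α.overline.Rel (Sum.inl j) (Sum.inl i) ↔ ¬ j.val < r ∧ (j.val - r) / 2 = (i.val - r) / 2 := by
    intro i j h
    simp only [PartitionMonoid.overline, ofLabel_rel, Sum.elim_inl]
    rw [dif_neg h]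
    by_cases hj : j.val < r
    · rw [dif_pos hj]; simp [hj]
    · rw [dif_neg hj, Sum.inr.injEq]; exact ⟨fun e => ⟨hj, e⟩, fun e => e.2⟩
  rw [isBrauer_iff]
  rintro (i | i)
  · have hi := i.isLt
    by_cases h : i.val < r
    · obtain ⟨k, hk⟩ := mem_dom.1 (amem ⟨i, h⟩)
      have hk1 := (hr _ _).1 hk.symm
      rw [or_iff_right (by simp)] at hk1
      refine ⟨Sum.inr k, by simp, ?_⟩
      rintro (j | j)
      · by_cases hj : j.val < r
        · simp [huu j i hj h]
        · have h1 : ¬ α.overline.Rel (Sum.inl j) (Sum.inl i) := fun e =>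
            ((huv j i hj).1 e.symm).1 h
          have h2 : j ≠ i := fun e => hj (e ▸ h)
          simp [h1, h2]
      · rw [show α.overline.Rel (Sum.inr j) (Sum.inl i) ↔ α.overline.Rel (Sum.inl i) (Sum.inr j)
          from ⟨Rel.symm, Rel.symm⟩, hul i h]
        rw [show α.Rel (Sum.inl (a ⟨i, h⟩)) (Sum.inr j) ↔ α.Rel (Sum.inr j) (Sum.inl (a ⟨i, h⟩))
          from ⟨Rel.symm, Rel.symm⟩, hr, ← hk1]
        simp
    · refine ⟨Sum.inl ⟨if (i.val - r) % 2 = 0 then i.val + 1 else i.val - 1,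
        by split_ifs <;> omega⟩, ?_, ?_⟩
      · rw [Ne, Sum.inl.injEq, Fin.ext_iff]
        dsimp only
        split_ifs <;> omega
      · rintro (k | k)
        · rw [huv i k h, Sum.inl.injEq, Sum.inl.injEq, Fin.ext_iff, Fin.ext_iff]
          dsimp only
          split_ifs <;> omega
        · have h1 : ¬ α.overline.Rel (Sum.inr k) (Sum.inl i) := fun e => hul' i h k e.symm
          simp [h1]
  · rcases hfi : f (Sum.inr i) with x | x
    · have hx : α.Rel (Sum.inl x) (Sum.inr i) := (hr _ _).2 (Or.inr hfi.symm)
      obtain ⟨t, ht⟩ := asurj x (mem_dom.2 ⟨i, hx⟩)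
      have htn : t.val < n := lt_of_lt_of_le t.isLt hle
      refine ⟨Sum.inl ⟨t.val, htn⟩, by simp, ?_⟩
      rintro (k | k)
      · by_cases hk : k.val < r
        · rw [hul k hk, hr, hfi, ← ht]
          simp [ainj.eq_iff, Fin.ext_iff]
        · have h1 := hul' k hk i
          have h2 : k ≠ ⟨t.val, htn⟩ := fun e => hk (by rw [e]; exact t.isLt)
          simp [h1, h2]
      · rw [hll, hr, hfi]
        simp
    · have hx : f (Sum.inr i) = Sum.inr x := hfi
      refine ⟨Sum.inr x, fun e => hf _ (hx.trans e), ?_⟩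
      rintro (k | k)
      · by_cases hk : k.val < r
        · rw [hul k hk, hr, hfi]
          simp
        · have h1 := hul' k hk i
          simp [h1]
      · rw [hll, hr, hfi]

end PartitionMonoid

/-! ## The Brauer monoid -/

/-- The Brauer monoid: the submonoid of the partition monoid formed by the partitions all of whose
blocks have size two. -/
def BrauerMonoid (n : ℕ) : Submonoid (PartitionMonoid n) where
  carrier := {α | α.IsBrauer}
  one_mem' := PartitionMonoid.isBrauer_ofPerm 1
  mul_mem' := PartitionMonoid.IsBrauer.mul

namespace BrauerMonoid

variable {n : ℕ}

instance : Star (BrauerMonoid n) := ⟨fun α => ⟨star α.1, PartitionMonoid.IsBrauer.star α.2⟩⟩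

/-- The set `P_r` of projections (`ε ^ 2 = ε = ε*`) of rank `r`. -/
def projections (n r : ℕ) : Set (BrauerMonoid n) :=
  {ε | IsStarProjection ε ∧ ε.1.rank = r}

/-- The number `p_r` of projections of rank `r`. -/
noncomputable def numProjections (n r : ℕ) : ℕ := (projections n r).ncard

/-- The permutation `σ` as a Brauer partition, with blocks `{i, (i σ)'}`. -/
def perm (σ : Equiv.Perm (Fin n)) : BrauerMonoid n :=
  ⟨.ofPerm σ, PartitionMonoid.isBrauer_ofPerm σ⟩

/-- The map `α ↦ overline α` on the Brauer monoid. -/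
noncomputable def overline (α : BrauerMonoid n) : BrauerMonoid n :=
  ⟨α.1.overline, PartitionMonoid.IsBrauer.overline α.2⟩

open PartitionMonoid in
/-- Upper blocks `{1, 2}, {3, 4}, {5, 6}, …`, lower blocks `{1', 2'}, {3', 4'}, {5', 6'}, …`. -/
def zeta (_h4 : 4 ≤ n) (he : Even n) : BrauerMonoid n :=
  ⟨upperLower nested0 nested0, isBrauer_upperLower (nested0_pairing he) (nested0_pairing he)⟩

open PartitionMonoid in
/-- Upper blocks `{1, 4}, {2, 3}, {5, 6}, …`, lower blocks `{1', 2'}, {3', 4'}, {5', 6'}, …`. -/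
def alpha (h4 : 4 ≤ n) (he : Even n) : BrauerMonoid n :=
  ⟨upperLower nested1 nested0, isBrauer_upperLower (nested1_pairing h4 he) (nested0_pairing he)⟩

open PartitionMonoid in
/-- Upper blocks `{1, 2}, {3, 4}, {5, 6}, …`, lower blocks `{1', 4'}, {2', 3'}, {5', 6'}, …`. -/
def beta (h4 : 4 ≤ n) (he : Even n) : BrauerMonoid n :=
  ⟨upperLower nested0 nested1, isBrauer_upperLower (nested0_pairing he) (nested1_pairing h4 he)⟩

open PartitionMonoid in
/-- Transversals `{1, 1'}, {2, 2'}`, upper blocks `{3, 4}, {5, 6}, …`, lower blocks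
`{3', 4'}, {5', 6'}, …`. -/
def gamma (h4 : 4 ≤ n) (he : Even n) : BrauerMonoid n :=
  ⟨twoLines (fun i => i), isBrauer_twoLines h4 he (fun _ h => h) (fun _ _ => rfl)⟩

open PartitionMonoid in
/-- Transversals `{1, 2'}, {2, 1'}`, upper blocks `{3, 4}, {5, 6}, …`, lower blocks
`{3', 4'}, {5', 6'}, …`. -/
def delta (h4 : 4 ≤ n) (he : Even n) : BrauerMonoid n :=
  ⟨twoLines (fun i => 1 - i), isBrauer_twoLines h4 he (fun _ _ => by omega) (fun _ _ => by omega)⟩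

/-- The cyclic group `C₂ = ⟨(1, 2)⟩` of permutations. -/
def cyclic2 (h4 : 4 ≤ n) : Subgroup (Equiv.Perm (Fin n)) :=
  Subgroup.zpowers (Equiv.swap ⟨0, by omega⟩ ⟨1, by omega⟩)

/-- The cyclic group `C₃ = ⟨(1, 2, 3)⟩` of permutations. -/
def cyclic3 (h4 : 4 ≤ n) : Subgroup (Equiv.Perm (Fin n)) :=
  Subgroup.zpowers (List.formPerm [⟨0, by omega⟩, ⟨1, by omega⟩, ⟨2, by omega⟩])

end BrauerMonoid

/-- The set `x C P̄_r = {x (ξ ε̄) : ξ ∈ C, ε ∈ P_r}` for an action of the Brauer monoid, a point `x`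
and a group `C` of permutations. -/
def RightAction.projectionOrbit {n : ℕ} {X : Type*} (μ : RightAction (BrauerMonoid n) X) (x : X)
    (C : Subgroup (Equiv.Perm (Fin n))) (r : ℕ) : Set X :=
  {y | ∃ ξ ∈ C, ∃ ε ∈ BrauerMonoid.projections n r,
    y = μ.act x (BrauerMonoid.perm ξ * BrauerMonoid.overline ε)}

/-! ### Connections in products of Brauer partitions -/

namespace PartitionMonoid

variable {n : ℕ}

/-! A faithful action separates each of finitely many chosen pairs, and a point separating such a
pair has a large orbit of a controlled shape. The bound adds the sizes of these orbits, which are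
disjoint, and one further point.

In the higher ranks (`k = 2, 4` for even `n`, `k = 3` for odd `n`) the pair is a test pair `(A, B)`:
`A = cB` for a cycle `c` on the first `k` vertices, and `ωA = ωB` whenever `ω` has a standard upper
row beyond `k` and an upper block inside the first `k` vertices. If `x` separates `A` and `B` and
`σ` has rank `k` with standard upper row, then `σσ*` fixes `A` and `B` on the left. Hence `xσ = yω`
with a collapsing `ω` would give `xA = xB` (`IsTestPair.act_ne`). If `xσ = xτ` but some lower block
of `τ` is not one of `σ`, then a suitable `θ` keeps the rank of `σθ` while `τθ` collapses, a
contradiction. So `xσ` determines the lower blocks of `σ`, which determine the projection `ε`.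
Cancelling `ε̄` leaves two elements of `⟨c⟩`, which agree because otherwise their quotient is `c` or
its inverse and `xA = xB` again (`IsTestPair.injOn`). The orbit therefore has `orderOf c * p_k`
elements.

In the bottom rank (0 or 1), any identification `xσ = xτ` of different elements with standard upper
row can be multiplied on the right until it identifies the chosen pair (`act_eq_of_rank_zero`,
`act_eq_of_rank_one`). This gives `p_0` or `p_1` points.

Elements of lower rank collapse, so orbits of different ranks are disjoint. For the extra point, let
`A` have bottom rank and standard rows. No `yA` lies in a higher orbit. If every `yA` were in the
bottom orbit, then `y ↦ yA` would be constant, and `A = cB` would force `xA = xB`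
(`IsTestPair.exists_act_notMem`). -/

theorem mul_rel_inl_inl {α β : PartitionMonoid n} {i j : Fin n}
    (h : α.Rel (Sum.inl i) (Sum.inl j)) : (α * β).Rel (Sum.inl i) (Sum.inl j) :=
  (mul_rel _ _ _ _).2 (Conn.top (β := β) h)

theorem mul_rel_inr_inr {α β : PartitionMonoid n} {i j : Fin n}
    (h : β.Rel (Sum.inr i) (Sum.inr j)) : (α * β).Rel (Sum.inr i) (Sum.inr j) :=
  (mul_rel _ _ _ _).2 (Conn.bot (α := α) h)

theorem conn_top_mid {α β : PartitionMonoid n} {i a : Fin n}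
    (h : α.Rel (Sum.inl i) (Sum.inr a)) : Conn α β (outer (Sum.inl i)) (Sum.inr (Sum.inl a)) :=
  Conn.top (β := β) h

theorem conn_mid_bot {α β : PartitionMonoid n} {a i : Fin n}
    (h : β.Rel (Sum.inl a) (Sum.inr i)) : Conn α β (Sum.inr (Sum.inl a)) (outer (Sum.inr i)) :=
  Conn.bot (α := α) h

theorem conn_mid_top {α β : PartitionMonoid n} {a b : Fin n}
    (h : α.Rel (Sum.inr a) (Sum.inr b)) :
    Conn α β (Sum.inr (Sum.inl a)) (Sum.inr (Sum.inl b)) :=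
  Conn.top (β := β) h

theorem conn_mid_mid {α β : PartitionMonoid n} {a b : Fin n}
    (h : β.Rel (Sum.inl a) (Sum.inl b)) :
    Conn α β (Sum.inr (Sum.inl a)) (Sum.inr (Sum.inl b)) :=
  Conn.bot (α := α) h

theorem mul_rel_inl_inr {α β : PartitionMonoid n} {i a l : Fin n}
    (h : α.Rel (Sum.inl i) (Sum.inr a)) (h' : β.Rel (Sum.inl a) (Sum.inr l)) :
    (α * β).Rel (Sum.inl i) (Sum.inr l) :=
  (mul_rel _ _ _ _).2 ((conn_top_mid h).trans (conn_mid_bot h'))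

theorem mul_rel_inl_inl_of_cap {α β : PartitionMonoid n} {i j a b : Fin n}
    (h : α.Rel (Sum.inl i) (Sum.inr a)) (h' : β.Rel (Sum.inl a) (Sum.inl b))
    (h'' : α.Rel (Sum.inl j) (Sum.inr b)) : (α * β).Rel (Sum.inl i) (Sum.inl j) :=
  (mul_rel _ _ _ _).2
    (((conn_top_mid h).trans (conn_mid_mid h')).trans (conn_top_mid h'').symm)

theorem mul_rel_inr_inr_of_cup {α β : PartitionMonoid n} {i j a b : Fin n}
    (h : β.Rel (Sum.inl a) (Sum.inr i)) (h' : α.Rel (Sum.inr a) (Sum.inr b))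
    (h'' : β.Rel (Sum.inl b) (Sum.inr j)) : (α * β).Rel (Sum.inr i) (Sum.inr j) :=
  (mul_rel _ _ _ _).2
    (((conn_mid_bot h).symm.trans (conn_mid_top h')).trans (conn_mid_bot h''))

/-- Two Brauer partitions which share a block at all vertices except possibly at two of them are
equal. -/
theorem IsBrauer.eq_of_common {α β : PartitionMonoid n} (hα : α.IsBrauer) (hβ : β.IsBrauer)
    (p q : Fin n ⊕ Fin n) (h : ∀ x, x = p ∨ x = q ∨ ∃ y, y ≠ x ∧ α.Rel x y ∧ β.Rel x y) :
    α = β := by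
  obtain ⟨f, hf, hff, hfr⟩ := hα.exists_partner
  obtain ⟨g, hg, hgg, hgr⟩ := hβ.exists_partner
  have h1 : ∀ x, x ≠ p → x ≠ q → f x = g x := by
    intro x hp hq
    obtain ⟨y, hy, h1, h2⟩ := ((h x).resolve_left hp).resolve_left hq
    have e1 := ((hfr x y).1 h1.symm).resolve_left hy
    have e2 := ((hgr x y).1 h2.symm).resolve_left hy
    rw [← e1, ← e2]
  -- If one of `f p`, `g p` avoids both exceptional vertices, the two involutions agree there, and
  -- applying them once more identifies the partners of `p`. Otherwise both partners are `q`.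
  have key : ∀ p q, (∀ x, x ≠ p → x ≠ q → f x = g x) → f p = g p := by
    intro p q h1
    by_cases hq : g p = q
    · by_contra hne
      have h2 := h1 (f p) (hf p) (fun e => hne (e.trans hq.symm))
      rw [hff] at h2
      apply hne
      have h3 := congrArg g h2
      rw [hgg] at h3
      exact h3.symm
    · have h2 := h1 (g p) (hg p) hq
      rw [hgg] at h2
      have h3 := congrArg f h2
      rw [hff] at h3
      exact h3.symm
  have hfg : f = g := by
    funext x
    by_cases hp : x = p
    · rw [hp]; exact key p q h1
    · by_cases hq : x = q
      · rw [hq]; exact key q p (fun x a b => h1 x b a)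
      · exact h1 x hp hq
  apply ext_rel
  intro x y
  rw [hfr, hgr, hfg]

/-- Each vertex has exactly one partner, so containing the blocks of another Brauer partition
already forces equality. Consequently products can be identified by exhibiting connections only, and
it is never necessary to prove that two vertices are disconnected. -/
theorem IsBrauer.eq_of_le {α β : PartitionMonoid n} (hα : α.IsBrauer) (hβ : β.IsBrauer)
    (h : ∀ x y, x ≠ y → β.Rel x y → α.Rel x y) : α = β := by
  obtain ⟨f, hf, hff, hr⟩ := hβ.exists_partner
  rcases isEmpty_or_nonempty (Fin n ⊕ Fin n) with he | ⟨⟨p⟩⟩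
  · exact ext_rel fun x => he.elim x
  · refine hα.eq_of_common hβ p p fun x => Or.inr (Or.inr ⟨f x, hf x, ?_⟩)
    have := ((hr x (f x)).2 (Or.inr rfl)).symm
    exact ⟨h _ _ (hf x).symm this, this⟩

/-- In a Brauer partition the blocks have at most two elements. -/
theorem IsBrauer.rel_unique {α : PartitionMonoid n} (hα : α.IsBrauer) {x y z : Fin n ⊕ Fin n}
    (hy : y ≠ x) (hz : z ≠ x) (h : α.Rel x y) (h' : α.Rel x z) : y = z := by
  obtain ⟨f, hf, hff, hr⟩ := hα.exists_partner
  rw [((hr x y).1 h.symm).resolve_left hy, ((hr x z).1 h'.symm).resolve_left hz]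

theorem IsBrauer.exists_rel {α : PartitionMonoid n} (hα : α.IsBrauer) (x : Fin n ⊕ Fin n) :
    ∃ y, y ≠ x ∧ α.Rel x y := by
  obtain ⟨f, hf, hff, hr⟩ := hα.exists_partner
  exact ⟨f x, hf x, ((hr x _).2 (Or.inr rfl)).symm⟩

theorem IsBrauer.rank_eq_card_dom {α : PartitionMonoid n} (hα : α.IsBrauer) :
    α.rank = α.dom.card := by
  have h1 : α.transversals = (fun i => α.block (Sum.inl i)) '' (α.dom : Set (Fin n)) := by
    ext B
    constructor
    · rintro ⟨⟨x, rfl⟩, ⟨i, hi⟩, j, hj⟩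
      refine ⟨i, ?_, ?_⟩
      · exact mem_dom.2 ⟨j, Rel.trans hi (Rel.symm hj)⟩
      · exact block_eq.2 hi
    · rintro ⟨i, hi, rfl⟩
      obtain ⟨j, hj⟩ := mem_dom.1 hi
      exact ⟨⟨Sum.inl i, rfl⟩, ⟨i, Rel.refl _ _⟩, j, hj.symm⟩
  rw [rank, h1, Set.InjOn.ncard_image, Set.ncard_coe_finset]
  intro i hi j hj h
  have h2 : α.Rel (Sum.inl i) (Sum.inl j) := block_eq.1 h
  obtain ⟨l, hl⟩ := mem_dom.1 hi
  by_contra hne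
  have := hα.rel_unique (y := Sum.inl j) (z := Sum.inr l) (by simpa using Ne.symm hne) (by simp)
    h2 hl
  simp at this

end PartitionMonoid

/-! ### Relabelling, permutations and elements with standard rows -/

namespace BrauerMonoid

open PartitionMonoid

variable {n : ℕ}

/-- Rename the vertices of a Brauer partition by a permutation of all of them. -/
def relabel (s : Equiv.Perm (Fin n ⊕ Fin n)) (α : BrauerMonoid n) : BrauerMonoid n :=
  ⟨(Setoid.comap s α.1 : Setoid _), by
    have h := isBrauer_iff.1 α.2
    refine isBrauer_iff.2 fun x => ?_
    obtain ⟨y, hy, hr⟩ := h (s x)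
    refine ⟨s.symm y, fun e => hy (by rw [← e]; simp), fun z => ?_⟩
    change α.1.Rel (s z) (s x) ↔ _
    rw [hr, s.injective.eq_iff, Equiv.eq_symm_apply]⟩

theorem relabel_rel (s : Equiv.Perm (Fin n ⊕ Fin n)) (α : BrauerMonoid n) (x y) :
    (relabel s α).1.Rel x y ↔ α.1.Rel (s x) (s y) := Iff.rfl

theorem star_rel' (α : BrauerMonoid n) (x y) :
    (star α).1.Rel x y ↔ α.1.Rel x.swap y.swap := Iff.rfl

theorem eq_of_le {α β : BrauerMonoid n} (h : ∀ x y, x ≠ y → β.1.Rel x y → α.1.Rel x y) : α = β :=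
  Subtype.ext (α.2.eq_of_le β.2 h)

theorem eq_of_common {α β : BrauerMonoid n} (p q : Fin n ⊕ Fin n)
    (h : ∀ x, x = p ∨ x = q ∨ ∃ y, y ≠ x ∧ α.1.Rel x y ∧ β.1.Rel x y) : α = β :=
  Subtype.ext (α.2.eq_of_common β.2 p q h)

theorem perm_mul_eq_relabel (ξ : Equiv.Perm (Fin n)) (α : BrauerMonoid n) :
    perm ξ * α = relabel (Equiv.sumCongr ξ 1) α := by
  have hp : ∀ i : Fin n, (perm ξ).1.Rel (Sum.inl i) (Sum.inr (ξ i)) := fun i => rfl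
  apply eq_of_le
  rintro (i | i) (j | j) - h
  · exact mul_rel_inl_inl_of_cap (hp i) h (hp j)
  · exact mul_rel_inl_inr (hp i) h
  · exact (mul_rel_inl_inr (hp j) h.symm).symm
  · exact mul_rel_inr_inr h

theorem perm_mul_rel (ξ : Equiv.Perm (Fin n)) (α : BrauerMonoid n) (x y) :
    (perm ξ * α).1.Rel x y ↔ α.1.Rel (Sum.map ξ id x) (Sum.map ξ id y) := by
  rw [perm_mul_eq_relabel, relabel_rel]
  rcases x with x | x <;> rcases y with y | y <;> rfl

theorem ext_rel' {α β : BrauerMonoid n} (h : ∀ x y, α.1.Rel x y ↔ β.1.Rel x y) : α = β :=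
  Subtype.ext (PartitionMonoid.ext_rel h)

/-- The order is reversed because diagrams compose from left to right, whereas `Equiv.Perm` composes
from right to left. -/
theorem perm_mul_perm (ξ η : Equiv.Perm (Fin n)) : perm ξ * perm η = perm (η * ξ) := by
  refine ext_rel' fun x y => ?_
  rw [perm_mul_rel]
  rcases x with x | x <;> rcases y with y | y <;> exact Iff.rfl

theorem perm_one : perm (1 : Equiv.Perm (Fin n)) = 1 := by
  refine ext_rel' fun x y => ?_
  rcases x with x | x <;> rcases y with y | y <;> exact Iff.rfl

/-- The upper blocks outside the first `k` vertices are `{k + 1, k + 2}, {k + 3, k + 4}, …`. -/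
def StdUpper (k : ℕ) (α : BrauerMonoid n) : Prop :=
  ∀ i j : Fin n, k ≤ i.val → k ≤ j.val → (i.val - k) / 2 = (j.val - k) / 2 →
    α.1.Rel (Sum.inl i) (Sum.inl j)

/-- The lower blocks outside the first `k` vertices are `{k + 1, k + 2}, {k + 3, k + 4}, …`. -/
def StdLower (k : ℕ) (α : BrauerMonoid n) : Prop :=
  ∀ i j : Fin n, k ≤ i.val → k ≤ j.val → (i.val - k) / 2 = (j.val - k) / 2 →
    α.1.Rel (Sum.inr i) (Sum.inr j)

/-- Membership in the `𝓡`-class of rank `k` with standard upper row. -/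
structure InStdRClass (k : ℕ) (α : BrauerMonoid n) : Prop where
  std : StdUpper k α
  trans : ∀ i : Fin n, i.val < k → ∃ j : Fin n, α.1.Rel (Sum.inl i) (Sum.inr j)

theorem StdUpper.mul {k : ℕ} {α : BrauerMonoid n} (h : StdUpper k α) (β) : StdUpper k (α * β) :=
  fun i j hi hj e => mul_rel_inl_inl (h i j hi hj e)

theorem StdLower.mul {k : ℕ} {β : BrauerMonoid n} (h : StdLower k β) (α) : StdLower k (α * β) :=
  fun i j hi hj e => mul_rel_inr_inr (h i j hi hj e)

theorem StdUpper.perm_mul {k : ℕ} {α : BrauerMonoid n} (h : StdUpper k α) {ξ : Equiv.Perm (Fin n)}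
    (hξ : ∀ i : Fin n, k ≤ i.val → ξ i = i) : StdUpper k (perm ξ * α) := by
  intro i j hi hj e
  rw [perm_mul_rel]
  simpa [hξ i hi, hξ j hj] using h i j hi hj e

theorem exists_std_partner {k : ℕ} (hk : Even (n - k)) (i : Fin n) (hi : k ≤ i.val) :
    ∃ j : Fin n, j ≠ i ∧ k ≤ j.val ∧ (i.val - k) / 2 = (j.val - k) / 2 := by
  obtain ⟨m, hm⟩ := hk
  have := i.isLt
  refine ⟨⟨if (i.val - k) % 2 = 0 then i.val + 1 else i.val - 1, by split_ifs <;> omega⟩, ?_, ?_, ?_⟩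
  · rw [Ne, Fin.ext_iff]
    dsimp only
    split_ifs <;> omega
  · dsimp only
    split_ifs <;> omega
  · dsimp only
    split_ifs <;> omega

theorem StdUpper.exists_common {k : ℕ} (hk : Even (n - k)) {α β : BrauerMonoid n}
    (hα : StdUpper k α) (hβ : StdUpper k β) (i : Fin n) (hi : k ≤ i.val) :
    ∃ y, y ≠ Sum.inl i ∧ α.1.Rel (Sum.inl i) y ∧ β.1.Rel (Sum.inl i) y := by
  obtain ⟨j, hj, hkj, e⟩ := exists_std_partner hk i hi
  exact ⟨Sum.inl j, by simpa using hj, hα i j hi hkj e, hβ i j hi hkj e⟩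

theorem StdLower.exists_common {k : ℕ} (hk : Even (n - k)) {α β : BrauerMonoid n}
    (hα : StdLower k α) (hβ : StdLower k β) (i : Fin n) (hi : k ≤ i.val) :
    ∃ y, y ≠ Sum.inr i ∧ α.1.Rel (Sum.inr i) y ∧ β.1.Rel (Sum.inr i) y := by
  obtain ⟨j, hj, hkj, e⟩ := exists_std_partner hk i hi
  exact ⟨Sum.inr j, by simpa using hj, hα i j hi hkj e, hβ i j hi hkj e⟩

/-- In an element with standard upper row only the first `k` upper vertices can lie in
transversals. -/
theorem StdUpper.lt_of_rel_inr {k : ℕ} (hk : Even (n - k)) {α : BrauerMonoid n}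
    (hα : StdUpper k α) {i a : Fin n} (h : α.1.Rel (Sum.inl i) (Sum.inr a)) : i.val < k := by
  by_contra hi
  obtain ⟨j, hj, hkj, e⟩ := exists_std_partner hk i (by omega)
  have := α.2.rel_unique (by simpa using hj) (by simp) (hα i j (by omega) hkj e) h
  simp at this

/-- The product `σσ*` has vertical transversals at the first `k` vertices and a standard upper row
beyond them, so it acts as a left identity on everything with standard upper row. This makes `σ`
cancellable from points `xσ`. -/
theorem InStdRClass.mul_star_mul {k : ℕ} (hk : Even (n - k)) {σ ω : BrauerMonoid n}
    (hσ : InStdRClass k σ) (hω : StdUpper k ω) : σ * star σ * ω = ω := by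
  have hU : StdUpper k (σ * star σ) := hσ.std.mul _
  have hT : ∀ i : Fin n, i.val < k → (σ * star σ).1.Rel (Sum.inl i) (Sum.inr i) := by
    intro i hi
    obtain ⟨j, hj⟩ := hσ.trans i hi
    exact mul_rel_inl_inr hj (hj.symm : (star σ).1.Rel (Sum.inl j) (Sum.inr i))
  -- a standard upper vertex is only related to its standard partner
  have hfix : ∀ i : Fin n, k ≤ i.val → ∀ y, y ≠ Sum.inl i → ω.1.Rel (Sum.inl i) y →
      (σ * star σ * ω).1.Rel (Sum.inl i) y := by
    intro i hi y hy h
    obtain ⟨z, hz, h1, h2⟩ := StdUpper.exists_common hk (hU.mul ω) hω i hi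
    rw [ω.2.rel_unique hy hz h h2]
    exact h1
  apply eq_of_le
  rintro (i | i) (j | j) hne h
  · by_cases hi : i.val < k
    · by_cases hj : j.val < k
      · exact mul_rel_inl_inl_of_cap (hT i hi) h (hT j hj)
      · exact (hfix j (by omega) _ hne h.symm).symm
    · exact hfix i (by omega) _ hne.symm h
  · exact mul_rel_inl_inr (hT i (hω.lt_of_rel_inr hk h)) h
  · exact (mul_rel_inl_inr (hT j (hω.lt_of_rel_inr hk h.symm)) h.symm).symm
  · exact mul_rel_inr_inr h

end BrauerMonoid

/-! ### Separating two lower vertices without losing rank -/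

namespace BrauerMonoid

open PartitionMonoid

variable {n : ℕ}

/-- Given two lower vertices which do not form a block of `σ`, some `θ` connects them to two
vertices below without decreasing the rank of `σ`. -/
theorem InStdRClass.exists_mul {k : ℕ} (h2 : 2 ≤ k) (hkn : k ≤ n) (hk : Even (n - k))
    {σ : BrauerMonoid n} (hσ : InStdRClass k σ) {a b : Fin n} (hab : a ≠ b)
    (hnot : ¬ σ.1.Rel (Sum.inr a) (Sum.inr b)) :
    ∃ θ : BrauerMonoid n, InStdRClass k (σ * θ) ∧ StdLower k θ ∧ ∃ i j : Fin n, i ≠ j ∧ i.val < k ∧ j.val < k ∧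
      θ.1.Rel (Sum.inl a) (Sum.inr i) ∧ θ.1.Rel (Sum.inl b) (Sum.inr j) := by
  have hp' : ∀ i : Fin n, ∃ p : Fin n, i.val < k → σ.1.Rel (Sum.inl i) (Sum.inr p) := fun i => by
    by_cases hi : i.val < k
    · obtain ⟨p, hp⟩ := hσ.trans i hi
      exact ⟨p, fun _ => hp⟩
    · exact ⟨i, fun h => absurd h hi⟩
  choose p hp using hp'
  have pinj : ∀ i j : Fin n, i.val < k → j.val < k → p i = p j → i = j := by
    intro i j hi hj e
    have h1 := (hp i hi).symm
    rw [e] at h1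
    exact Sum.inl.inj (σ.2.rel_unique (by simp) (by simp) h1 (hp j hj).symm)
  have hex : ∀ c : Fin n, ∃ i : Fin n, i.val < k ∧ ∀ j : Fin n, j.val < k → c = p j → j = i := by
    intro c
    by_cases h : ∃ i : Fin n, i.val < k ∧ c = p i
    · obtain ⟨i, hi, rfl⟩ := h
      exact ⟨i, hi, fun j hj e => (pinj i j hi hj e).symm⟩
    -- When `c` is not the lower end of a transversal any index serves, since the condition is
    -- vacuous.
    · exact ⟨⟨0, by omega⟩, by simp; omega, fun j hj e => absurd ⟨j, hj, e⟩ h⟩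
  -- The targets are forced where `a` or `b` already ends a transversal of `σ`; otherwise they are
  -- free, and `2 ≤ k` leaves room to make them distinct.
  obtain ⟨i₀, j₀, hne, hi₀, hj₀, ha, hb⟩ : ∃ i₀ j₀ : Fin n, i₀ ≠ j₀ ∧ i₀.val < k ∧ j₀.val < k ∧
      (∀ j : Fin n, j.val < k → a = p j → j = i₀) ∧
      ∀ j : Fin n, j.val < k → b = p j → j = j₀ := by
    have hother : ∀ i : Fin n, ∃ j : Fin n, i ≠ j ∧ j.val < k := by
      intro i
      by_cases h : i.val = 0
      · exact ⟨⟨1, by omega⟩, by simp [Fin.ext_iff, h], by simp; omega⟩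
      · exact ⟨⟨0, by omega⟩, by simpa [Fin.ext_iff] using h, by simp; omega⟩
    obtain ⟨i, hi, ha⟩ := hex a
    by_cases h : ∃ j : Fin n, j.val < k ∧ b = p j
    · obtain ⟨j, hj, rfl⟩ := h
      by_cases hij : i = j
      · obtain ⟨l, hl, hlk⟩ := hother j
        refine ⟨l, j, hl.symm, hlk, hj, fun m hm e => ?_, fun m hm e => (pinj j m hj hm e).symm⟩
        exact absurd (by rw [e, ha m hm e, hij]) hab
      · exact ⟨i, j, hij, hi, hj, ha, fun m hm e => (pinj j m hj hm e).symm⟩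
    · obtain ⟨l, hl, hlk⟩ := hother i
      exact ⟨i, l, hl, hi, hlk, ha, fun j hj e => absurd ⟨j, hj, e⟩ h⟩
  have haq : a ≠ p j₀ := fun e => hne (ha j₀ hj₀ e).symm
  have hbp : b ≠ p i₀ := fun e => hne (hb i₀ hi₀ e)
  have hpq : p i₀ ≠ p j₀ := fun e => hne (pinj _ _ hi₀ hj₀ e)
  set s : Equiv.Perm (Fin n) := Equiv.swap a (p i₀) * Equiv.swap b (p j₀) with hs
  have sa : s a = p i₀ := by
    rw [hs, Equiv.Perm.mul_apply, Equiv.swap_apply_of_ne_of_ne hab haq, Equiv.swap_apply_left]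
  have sb : s b = p j₀ := by
    rw [hs, Equiv.Perm.mul_apply, Equiv.swap_apply_left,
      Equiv.swap_apply_of_ne_of_ne haq.symm hpq.symm]
  have sp : s (p i₀) = a := by
    rw [hs, Equiv.Perm.mul_apply, Equiv.swap_apply_of_ne_of_ne hbp.symm hpq,
      Equiv.swap_apply_right]
  have sq : s (p j₀) = b := by
    rw [hs, Equiv.Perm.mul_apply, Equiv.swap_apply_right,
      Equiv.swap_apply_of_ne_of_ne hab.symm hbp]
  have sc : ∀ c, c ≠ a → c ≠ b → c ≠ p i₀ → c ≠ p j₀ → s c = c := by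
    intro c h1 h2 h3 h4
    rw [hs, Equiv.Perm.mul_apply, Equiv.swap_apply_of_ne_of_ne h2 h4,
      Equiv.swap_apply_of_ne_of_ne h1 h3]
  -- Start from `σ*`, which returns every transversal to its origin, and exchange `a` with `p i₀`
  -- and `b` with `p j₀` in its upper row. The lower row stays standard.
  set θ : BrauerMonoid n := relabel (Equiv.sumCongr s 1) (star σ) with hθ
  have hθlr : ∀ x y : Fin n, θ.1.Rel (Sum.inl x) (Sum.inr y) ↔
      σ.1.Rel (Sum.inr (s x)) (Sum.inl y) := fun x y => Iff.rfl
  have hθll : ∀ x y : Fin n, θ.1.Rel (Sum.inl x) (Sum.inl y) ↔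
      σ.1.Rel (Sum.inr (s x)) (Sum.inr (s y)) := fun x y => Iff.rfl
  have hai : θ.1.Rel (Sum.inl a) (Sum.inr i₀) := by
    rw [hθlr, sa]; exact (hp i₀ hi₀).symm
  have hbj : θ.1.Rel (Sum.inl b) (Sum.inr j₀) := by
    rw [hθlr, sb]; exact (hp j₀ hj₀).symm
  -- The rerouted transversal survives. If `d` is not `p l`, then `d` has a lower partner `c` in
  -- `σ`, and the route is `l`, `p l`, `c`, `d`, `l'`, using `σ`, `θ`, `σ`, `θ` in turn. The vertex
  -- `c` is untouched by `s`, because `{d, d'}` is not a block and `c` ends no transversal.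
  have hpath : ∀ d d' e e' : Fin n, ∀ l : Fin n, l.val < k → (∀ j : Fin n, j.val < k → d = p j → j = l) →
      d ≠ d' → ¬ σ.1.Rel (Sum.inr d) (Sum.inr d') → s (p l) = d →
      (∀ c, c ≠ d → c ≠ d' → c ≠ p l → c ≠ e' → s c = c) → (∃ m : Fin n, m.val < k ∧ e' = p m) →
      θ.1.Rel (Sum.inl d) (Sum.inr l) → (σ * θ).1.Rel (Sum.inl l) (Sum.inr l) := by
    intro d d' e e' l hl hd hdd hno hspl hfix hm hdl
    by_cases hdp : d = p l
    · rw [hdp] at hdl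
      exact mul_rel_inl_inr (hp l hl) hdl
    · obtain ⟨y, hy, hdy⟩ := σ.2.exists_rel (Sum.inr d)
      rcases y with y | c
      · exfalso
        have hyk := hσ.std.lt_of_rel_inr hk hdy.symm
        have h3 : d = p y := Sum.inr.inj (σ.2.rel_unique (by simp) (by simp) hdy.symm (hp y hyk))
        rw [hd y hyk h3] at h3
        exact hdp h3
      · have hcd : c ≠ d := by simpa using hy
        have hcd' : c ≠ d' := fun e => hno (e ▸ hdy)
        have hcp : ∀ m : Fin n, m.val < k → c ≠ p m := by
          intro m hm e
          rw [e] at hdy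
          have := σ.2.rel_unique (by simpa [← e] using hcd.symm) (by simp) hdy.symm (hp m hm).symm
          simp at this
        have h4 : θ.1.Rel (Sum.inl (p l)) (Sum.inl c) := by
          rw [hθll, hspl, hfix c hcd hcd' (hcp l hl)
            (by obtain ⟨m, hm, rfl⟩ := hm; exact hcp m hm)]
          exact hdy
        exact (mul_rel _ _ _ _).2 ((((conn_top_mid (hp l hl)).trans (conn_mid_mid h4)).trans
          (conn_mid_top hdy.symm)).trans (conn_mid_bot hdl))
  refine ⟨θ, ⟨hσ.std.mul _, fun i hi => ⟨i, ?_⟩⟩, fun i j hi hj e => hσ.std i j hi hj e,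
    i₀, j₀, hne, hi₀, hj₀, hai, hbj⟩
  by_cases h1 : i = i₀
  · subst h1
    exact hpath a b b (p j₀) i hi ha hab hnot sp (fun c h1 h2 h3 h4 => sc c h1 h2 h3 h4)
      ⟨j₀, hj₀, rfl⟩ hai
  · by_cases h2 : i = j₀
    · subst h2
      exact hpath b a a (p i₀) i hi hb hab.symm (fun h => hnot h.symm) sq
        (fun c h1 h2 h3 h4 => sc c h2 h1 h4 h3) ⟨i₀, hi₀, rfl⟩ hbj
    · refine mul_rel_inl_inr (hp i hi) ?_
      rw [hθlr, sc]
      · exact (hp i hi).symm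
      · exact fun e => h1 (ha i hi e.symm)
      · exact fun e => h2 (hb i hi e.symm)
      · exact fun e => h1 (pinj _ _ hi hi₀ e)
      · exact fun e => h2 (pinj _ _ hi hj₀ e)

/-! ### Projections and their normal forms -/

theorem projections_rel_star {r : ℕ} {ε : BrauerMonoid n} (h : ε ∈ projections n r) (x y) :
    ε.1.Rel x y ↔ ε.1.Rel x.swap y.swap := by
  have h1 : star ε = ε := h.1.isSelfAdjoint
  conv_lhs => rw [← h1]
  exact star_rel' _ _ _

/-- The transversals of a projection are vertical. -/
theorem projections_rel_inl_inr {r : ℕ} {ε : BrauerMonoid n} (h : ε ∈ projections n r)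
    {i j : Fin n} (hij : ε.1.Rel (Sum.inl i) (Sum.inr j)) : i = j := by
  have h2 : ε * ε = ε := h.1.isIdempotentElem
  have h3 : ε.1.Rel (Sum.inr i) (Sum.inl j) := (projections_rel_star h _ _).1 hij
  -- By symmetry `ε` also joins `j` to `i'`, so `ε²` joins `i` to `i'`.
  have h4 : (ε * ε).1.Rel (Sum.inl i) (Sum.inr i) := mul_rel_inl_inr hij h3.symm
  rw [h2] at h4
  exact Sum.inr.inj (ε.2.rel_unique (by simp) (by simp) h4 hij)

/-- A projection is determined by its lower blocks. -/
theorem projections_ext {r : ℕ} {ε η : BrauerMonoid n} (hε : ε ∈ projections n r)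
    (hη : η ∈ projections n r)
    (h : ∀ a b, ε.1.Rel (Sum.inr a) (Sum.inr b) ↔ η.1.Rel (Sum.inr a) (Sum.inr b)) : ε = η := by
  have hu : ∀ a b, ε.1.Rel (Sum.inl a) (Sum.inl b) ↔ η.1.Rel (Sum.inl a) (Sum.inl b) := by
    intro a b
    rw [projections_rel_star hε, projections_rel_star hη]
    exact h a b
  have hv : ∀ a b, η.1.Rel (Sum.inl a) (Sum.inr b) → ε.1.Rel (Sum.inl a) (Sum.inr b) := by
    intro a b hab
    obtain rfl := projections_rel_inl_inr hη hab
    obtain ⟨y, hy, hr⟩ := ε.2.exists_rel (Sum.inl a)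
    rcases y with y | y
    · have := η.2.rel_unique hy (by simp) ((hu _ _).1 hr) hab
      simp at this
    · obtain rfl := projections_rel_inl_inr hε hr
      exact hr
  apply eq_of_le
  rintro (i | i) (j | j) - hr
  · exact (hu _ _).2 hr
  · exact hv _ _ hr
  · exact (hv _ _ hr.symm).symm
  · exact (h _ _).2 hr

theorem overline_rel_inr_inr (α : BrauerMonoid n) (a b : Fin n) :
    (overline α).1.Rel (Sum.inr a) (Sum.inr b) ↔ α.1.Rel (Sum.inr a) (Sum.inr b) := by
  simp [overline, PartitionMonoid.overline, ofLabel_rel, block_eq]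

theorem overline_inStdRClass (α : BrauerMonoid n) : InStdRClass α.1.rank (overline α) := by
  have hr := α.2.rank_eq_card_dom
  constructor
  · intro i j hi hj e
    rw [hr] at hi hj e
    simp only [overline, PartitionMonoid.overline, ofLabel_rel, Sum.elim_inl]
    rw [dif_neg (by omega), dif_neg (by omega), e]
  · intro i hi
    rw [hr] at hi
    obtain ⟨j, hj⟩ := mem_dom.1 (Finset.orderEmbOfFin_mem α.1.dom rfl ⟨i.val, hi⟩)
    refine ⟨j, ?_⟩
    simp only [overline, PartitionMonoid.overline, ofLabel_rel, Sum.elim_inl, Sum.elim_inr]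
    rw [dif_pos hi, Sum.inl.injEq, block_eq]
    exact hj

theorem overline_projection {k : ℕ} {ε : BrauerMonoid n} (h : ε ∈ projections n k) :
    InStdRClass k (overline ε) := by
  have := overline_inStdRClass ε
  rwa [h.2] at this

theorem InStdRClass.perm_mul {k : ℕ} {α : BrauerMonoid n} (h : InStdRClass k α)
    {ξ : Equiv.Perm (Fin n)} (hξ : ∀ i : Fin n, k ≤ i.val → ξ i = i) :
    InStdRClass k (perm ξ * α) := by
  refine ⟨h.std.perm_mul hξ, fun i hi => ?_⟩
  have h1 : (ξ i).val < k := by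
    by_contra h2
    have h3 := hξ (ξ i) (by omega)
    rw [ξ.injective h3] at h2
    omega
  obtain ⟨j, hj⟩ := h.trans _ h1
  exact ⟨j, (perm_mul_rel _ _ _ _).2 hj⟩

/-! ### Test pairs and orbits in the higher ranks -/

/-- The pair `(A, B)` is used to test for collapse in rank `k` under the cyclic group generated by
the permutation `c` of the first `k` vertices. -/
structure IsTestPair (k : ℕ) (c : Equiv.Perm (Fin n)) (A B : BrauerMonoid n) : Prop where
  two_le : 2 ≤ k
  le : k ≤ n
  even : Even (n - k)
  fix : ∀ i : Fin n, k ≤ i.val → c i = i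
  perm_mul : perm c * B = A
  std : StdUpper k B
  collapse : ∀ ω : BrauerMonoid n, StdUpper k ω →
    (∃ i j : Fin n, i ≠ j ∧ i.val < k ∧ j.val < k ∧ ω.1.Rel (Sum.inl i) (Sum.inl j)) →
      ω * A = ω * B
  -- Every nontrivial quotient of two group elements is then `c` up to inversion, so identifying
  -- them identifies `A` with `B`.
  zpowers : ∀ g ∈ Subgroup.zpowers c, g = 1 ∨ g = c ∨ g⁻¹ = c

variable {k : ℕ} {c : Equiv.Perm (Fin n)} {A B : BrauerMonoid n}

theorem IsTestPair.fix_of_mem (h : IsTestPair k c A B) {g : Equiv.Perm (Fin n)}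
    (hg : g ∈ Subgroup.zpowers c) (i : Fin n) (hi : k ≤ i.val) : g i = i := by
  obtain ⟨m, rfl⟩ := hg
  exact Equiv.Perm.zpow_apply_eq_self_of_apply_eq_self (h.fix i hi) m

variable {X : Type*} {μ : RightAction (BrauerMonoid n) X}

/-- A counting argument: without such an upper block, the first `k` upper vertices would all be
joined to the first `k` lower ones, injectively and hence surjectively, leaving no room for a lower
block through `i`. -/
theorem exists_upper_block_of_lower (hk : Even (n - k)) {ω : BrauerMonoid n} (hω : StdUpper k ω)
    (hl : StdLower k ω) {i j : Fin n} (hij : i ≠ j) (hi : i.val < k)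
    (hr : ω.1.Rel (Sum.inr i) (Sum.inr j)) :
    ∃ i j : Fin n, i ≠ j ∧ i.val < k ∧ j.val < k ∧ ω.1.Rel (Sum.inl i) (Sum.inl j) := by
  by_contra hno
  have key : ∀ l : {l : Fin n // l.val < k}, ∃ m : {m : Fin n // m.val < k},
      ω.1.Rel (Sum.inl l.1) (Sum.inr m.1) := by
    rintro ⟨l, hlk⟩
    obtain ⟨y, hy, h⟩ := ω.2.exists_rel (Sum.inl l)
    rcases y with y | y
    · exfalso
      have hyl : y ≠ l := by simpa using hy
      by_cases hyk : y.val < k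
      · exact hno ⟨y, l, hyl, hyk, hlk, h.symm⟩
      · obtain ⟨m, hm, hkm, e⟩ := exists_std_partner hk y (by omega)
        have h3 := hω y m (by omega) hkm e
        have h4 := ω.2.rel_unique (by simpa using hm) (by simpa using hyl.symm) h3 h.symm
        rw [Sum.inl.inj h4] at hkm
        omega
    · refine ⟨⟨y, ?_⟩, h⟩
      by_contra hyk
      obtain ⟨m, hm, hkm, e⟩ := exists_std_partner hk y (by omega)
      have := ω.2.rel_unique (by simpa using hm) (by simp) (hl y m (by omega) hkm e) h.symm
      simp at this
  choose f hf using key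
  have finj : Function.Injective f := by
    intro a b e
    have h1 := (hf a).symm
    rw [e] at h1
    exact Subtype.ext (Sum.inl.inj (ω.2.rel_unique (by simp) (by simp) h1 (hf b).symm))
  obtain ⟨l, hl⟩ := Finite.surjective_of_injective finj ⟨i, hi⟩
  have h1 := hf l
  rw [hl] at h1
  have := ω.2.rel_unique (by simp) (by simpa using hij.symm) h1.symm hr
  simp at this

/-- Points of rank `k` are different from all points of the form `y ω` with `ω` collapsing. -/
theorem IsTestPair.act_ne (h : IsTestPair k c A B) {x : X} (hx : μ.Witnesses x A B)
    {σ ω : BrauerMonoid n} (hσ : InStdRClass k σ) (hω : StdUpper k ω)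
    (hc : ∃ i j : Fin n, i ≠ j ∧ i.val < k ∧ j.val < k ∧ ω.1.Rel (Sum.inl i) (Sum.inl j)) (y : X) :
    μ.act x σ ≠ μ.act y ω := by
  intro e
  have hA : StdUpper k A := h.perm_mul ▸ h.std.perm_mul h.fix
  obtain ⟨i, j, hij, hi, hj, hr⟩ := hc
  have h1 := h.collapse (ω * star σ) (hω.mul _) ⟨i, j, hij, hi, hj, mul_rel_inl_inl hr⟩
  apply hx
  -- The chain is `xA = xσσ*A = yωσ*A = yωσ*B = xσσ*B = xB`.
  rw [← hσ.mul_star_mul h.even hA, ← hσ.mul_star_mul h.even h.std, mul_assoc, mul_assoc,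
    ← μ.act_mul, ← μ.act_mul x, e, μ.act_mul, μ.act_mul, ← mul_assoc, ← mul_assoc, h1]

/-- If `{a, b}` were not a block of `σ`, the `θ` of `InStdRClass.exists_mul` would keep `σθ` in rank
`k` while turning `{a, b}` into a lower block of `τθ` inside the first `k` vertices. By counting,
`τθ` then collapses, so `xσθ = xτθ` contradicts `IsTestPair.act_ne`. -/
theorem IsTestPair.rel_of_act_eq (h : IsTestPair k c A B) {x : X} (hx : μ.Witnesses x A B)
    {σ τ : BrauerMonoid n} (hσ : InStdRClass k σ) (hτ : InStdRClass k τ)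
    (e : μ.act x σ = μ.act x τ) {a b : Fin n} (hab : τ.1.Rel (Sum.inr a) (Sum.inr b)) :
    σ.1.Rel (Sum.inr a) (Sum.inr b) := by
  by_contra hno
  have hne : a ≠ b := by
    rintro rfl
    exact hno (Rel.refl _ _)
  obtain ⟨θ, hθ, hθl, i, j, hij, hi, hj, hai, hbj⟩ := hσ.exists_mul h.two_le h.le h.even hne hno
  have hcup : (τ * θ).1.Rel (Sum.inr i) (Sum.inr j) := mul_rel_inr_inr_of_cup hai hab hbj
  refine h.act_ne hx hθ (hτ.std.mul θ) ?_ x (by rw [← μ.act_mul, e, μ.act_mul])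
  exact exists_upper_block_of_lower h.even (hτ.std.mul θ) (hθl.mul τ) hij hi hcup

/-- The map `(ξ, ε) ↦ x ξ ε̄` is injective. -/
theorem IsTestPair.injOn (h : IsTestPair k c A B) {x : X} (hx : μ.Witnesses x A B) :
    Set.InjOn (fun q : Equiv.Perm (Fin n) × BrauerMonoid n => μ.act x (perm q.1 * overline q.2))
      ((Subgroup.zpowers c : Set (Equiv.Perm (Fin n))) ×ˢ projections n k) := by
  rintro ⟨ξ, ε⟩ ⟨hξ, hε⟩ ⟨η, δ⟩ ⟨hη, hδ⟩ e
  have hξf := h.fix_of_mem hξ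
  have hηf := h.fix_of_mem hη
  dsimp only at hξ hη hε hδ e
  have h1 := overline_projection hε
  have h2 := overline_projection hδ
  have hrel : ∀ (ξ : Equiv.Perm (Fin n)) (ε : BrauerMonoid n) (a b : Fin n),
      (perm ξ * overline ε).1.Rel (Sum.inr a) (Sum.inr b) ↔ ε.1.Rel (Sum.inr a) (Sum.inr b) := by
    intro ξ ε a b
    rw [perm_mul_rel]
    exact overline_rel_inr_inr ε a b
  have hεδ : ε = δ := by
    refine projections_ext hε hδ fun a b => ?_
    rw [← hrel ξ, ← hrel η δ]
    exact ⟨h.rel_of_act_eq hx (h2.perm_mul hηf) (h1.perm_mul hξf) e.symm,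
      h.rel_of_act_eq hx (h1.perm_mul hξf) (h2.perm_mul hηf) e⟩
  subst hεδ
  -- Multiplying by the reflection of `ε̄` cancels the common projection part. With `ζ` the inverse
  -- of `ξ` or `η`, one side becomes `xB`, and the other becomes `xA` when the quotient is `c`.
  have key : ∀ ζ ∈ Subgroup.zpowers c, μ.act x (perm (ζ * ξ) * B) = μ.act x (perm (ζ * η) * B) := by
    intro ζ hζ
    have hB : StdUpper k (perm ζ * B) := h.std.perm_mul (h.fix_of_mem hζ)
    have h3 := congrArg (fun y => μ.act y (star (overline ε) * (perm ζ * B))) e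
    simp only [μ.act_mul] at h3
    rwa [mul_assoc, mul_assoc, ← mul_assoc (overline ε), h1.mul_star_mul h.even hB, ← mul_assoc,
      ← mul_assoc, perm_mul_perm, perm_mul_perm] at h3
  have hone : perm (1 : Equiv.Perm (Fin n)) * B = B := by rw [perm_one, one_mul]
  rcases h.zpowers (ξ⁻¹ * η) (mul_mem (inv_mem hξ) hη) with h4 | h4 | h4
  · rw [inv_mul_eq_one] at h4
    rw [h4]
  · have h5 := key ξ⁻¹ (inv_mem hξ)
    rw [inv_mul_cancel, h4, h.perm_mul, hone] at h5
    exact absurd h5.symm hx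
  · have h5 := key η⁻¹ (inv_mem hη)
    rw [mul_inv_rev, inv_inv] at h4
    rw [inv_mul_cancel, h4, h.perm_mul, hone] at h5
    exact absurd h5 hx

theorem projectionOrbit_eq_image (μ : RightAction (BrauerMonoid n) X) (x : X)
    (C : Subgroup (Equiv.Perm (Fin n))) (r : ℕ) : μ.projectionOrbit x C r =
      (fun q : Equiv.Perm (Fin n) × BrauerMonoid n => μ.act x (perm q.1 * overline q.2)) ''
        ((C : Set (Equiv.Perm (Fin n))) ×ˢ projections n r) := by
  ext y
  constructor
  · rintro ⟨ξ, hξ, ε, hε, rfl⟩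
    exact ⟨(ξ, ε), ⟨hξ, hε⟩, rfl⟩
  · rintro ⟨⟨ξ, ε⟩, ⟨hξ, hε⟩, rfl⟩
    exact ⟨ξ, hξ, ε, hε, rfl⟩

theorem IsTestPair.ncard_projectionOrbit (h : IsTestPair k c A B) {x : X}
    (hx : μ.Witnesses x A B) :
    (μ.projectionOrbit x (Subgroup.zpowers c) k).ncard = orderOf c * numProjections n k := by
  rw [projectionOrbit_eq_image, (h.injOn hx).ncard_image, Set.ncard_prod, numProjections,
    ← Nat.card_zpowers c, ← Nat.card_coe_set_eq]
  rfl

/-- Points of an orbit of rank `k` are no points of rank less than `k`. -/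
theorem IsTestPair.act_notMem (h : IsTestPair k c A B) {x : X} (hx : μ.Witnesses x A B)
    {l : ℕ} (hl : l < k) (hlk : Even (k - l)) {ω : BrauerMonoid n} (hω : StdUpper l ω) (y : X) :
    μ.act y ω ∉ μ.projectionOrbit x (Subgroup.zpowers c) k := by
  rintro ⟨ξ, hξ, ε, hε, e⟩
  have hkn := h.le
  obtain ⟨m, hm⟩ := hlk
  obtain ⟨m', hm'⟩ := h.even
  refine h.act_ne hx ((overline_projection hε).perm_mul (h.fix_of_mem hξ)) (ω := ω) ?_ ?_ y e.symm
  · intro i j hi hj e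
    exact hω i j (by omega) (by omega) (by omega)
  -- The first standard upper block beyond `l` lies inside the first `k` vertices, because `k - l`
  -- is even and positive.
  · exact ⟨⟨l, by omega⟩, ⟨l + 1, by omega⟩, by simp, hl, by simp; omega,
      hω _ _ (by simp) (by simp) (by simp)⟩

end BrauerMonoid

/-! ### Rank zero and rank one -/

namespace BrauerMonoid

open PartitionMonoid

variable {n k : ℕ}

/-- The standard blocks leave at most one vertex free in each row, and such a pair can only be
joined to each other. -/
theorem eq_of_stdUpper_of_stdLower (hn : 0 < n) (hk : Even (n - k)) (hk1 : k ≤ 1)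
    {α β : BrauerMonoid n} (hα : StdUpper k α) (hα' : StdLower k α) (hβ : StdUpper k β)
    (hβ' : StdLower k β) : α = β := by
  refine eq_of_common (Sum.inl ⟨0, hn⟩) (Sum.inr ⟨0, hn⟩) ?_
  rintro (i | i)
  · by_cases hi : k ≤ i.val
    · exact Or.inr (Or.inr (hα.exists_common hk hβ i hi))
    · left
      rw [Sum.inl.injEq, Fin.ext_iff]
      dsimp only
      omega
  · by_cases hi : k ≤ i.val
    · exact Or.inr (Or.inr (hα'.exists_common hk hβ' i hi))
    · right; left
      rw [Sum.inr.injEq, Fin.ext_iff]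
      dsimp only
      omega

variable {X : Type*} {μ : RightAction (BrauerMonoid n) X} {A B : BrauerMonoid n}

/-- In rank zero, a collapse of two elements yields the collapse of a test pair. -/
theorem act_eq_of_rank_zero (h4 : 4 ≤ n) (he : Even n) (hA : StdUpper 0 A) (hA' : StdLower 0 A)
    (hB : StdUpper 0 B) (hB' : StdLower 4 B)
    (hB03 : B.1.Rel (Sum.inr ⟨0, by omega⟩) (Sum.inr ⟨3, by omega⟩)) {x : X}
    {σ τ : BrauerMonoid n} (hσ : StdUpper 0 σ) (hτ : StdUpper 0 τ) (hne : σ ≠ τ)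
    (e : μ.act x σ = μ.act x τ) : μ.act x A = μ.act x B := by
  have he4 : Even (n - 4) := (Nat.even_sub h4).2 (by simp [he, show Even 4 by decide])
  have hlow : ∀ (α : BrauerMonoid n), StdUpper 0 α → ∀ a : Fin n, ∃ b : Fin n, b ≠ a ∧
      α.1.Rel (Sum.inr a) (Sum.inr b) := by
    intro α hα a
    obtain ⟨y, hy, h⟩ := α.2.exists_rel (Sum.inr a)
    rcases y with y | y
    · exact absurd (hα.lt_of_rel_inr (by simpa using he) h.symm) (by omega)
    · exact ⟨y, by simpa using hy, h⟩
  -- Both upper rows are standard without transversals, so different elements must differ in a lower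
  -- block.
  obtain ⟨a, b, hab, hno⟩ : ∃ a b : Fin n, σ.1.Rel (Sum.inr a) (Sum.inr b) ∧
      ¬ τ.1.Rel (Sum.inr a) (Sum.inr b) := by
    by_contra hcon
    push Not at hcon
    refine hne (eq_of_common (Sum.inr ⟨0, by omega⟩) (Sum.inr ⟨0, by omega⟩) ?_)
    rintro (i | i)
    · exact Or.inr (Or.inr (hσ.exists_common (by simpa using he) hτ i (by omega)))
    · obtain ⟨j, hj, h⟩ := hlow σ hσ i
      exact Or.inr (Or.inr ⟨Sum.inr j, by simpa using hj, h, hcon _ _ h⟩)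
  obtain ⟨a', haa, ha⟩ := hlow τ hτ a
  obtain ⟨b', hbb, hb⟩ := hlow τ hτ b
  have hne2 : a' ≠ b := by rintro rfl; exact hno ha
  have hne3 : b' ≠ a := by rintro rfl; exact hno hb.symm
  have hne4 : a' ≠ b' := by
    rintro rfl
    exact hno (ha.trans hb.symm)
  -- In `τ*` the blocks `{a, a'}` and `{b, b'}` lie above `{0, 1}` and `{2, 3}`. The two swaps cut
  -- these open into lines from `a`, `a'`, `b'`, `b` down to `0`, `1`, `2`, `3`. Under `θ` the
  -- blocks `{a, a'}` and `{b, b'}` of `τ` then give the lower blocks of `A`, while the block `{a,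
  -- b}` of `σ` gives the block `{0, 3}` of `B`.
  set s : Equiv.Perm (Fin n ⊕ Fin n) := Equiv.swap (Sum.inl a') (Sum.inr ⟨0, by omega⟩) *
    Equiv.swap (Sum.inl b') (Sum.inr ⟨3, by omega⟩) with hs
  have s1 : s (Sum.inl a) = Sum.inl a := by
    simp [hs, Equiv.swap_apply_def, hne3.symm, haa.symm]
  have s2 : s (Sum.inr ⟨0, by omega⟩) = Sum.inl a' := by
    simp [hs, Equiv.swap_apply_def]
  have s3 : s (Sum.inl a') = Sum.inr ⟨0, by omega⟩ := by
    simp [hs, Equiv.swap_apply_def, hne4]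
  have s4 : s (Sum.inl b) = Sum.inl b := by
    simp [hs, Equiv.swap_apply_def, hbb.symm, hne2.symm]
  have s5 : s (Sum.inr ⟨3, by omega⟩) = Sum.inl b' := by
    simp [hs, Equiv.swap_apply_def, hne4.symm]
  have s6 : ∀ i : Fin n, i.val ≠ 0 → i.val ≠ 3 → s (Sum.inr i) = Sum.inr i := by
    intro i h0 h3
    simp [hs, Equiv.swap_apply_def, Fin.ext_iff, h0, h3]
  set θ : BrauerMonoid n := relabel s (star τ) with hθ
  have t1 : θ.1.Rel (Sum.inl a) (Sum.inr ⟨0, by omega⟩) := by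
    rw [hθ, relabel_rel, s1, s2]; exact ha
  have t2 : θ.1.Rel (Sum.inl a') (Sum.inr ⟨1, by omega⟩) := by
    rw [hθ, relabel_rel, s3, s6 _ (by simp) (by simp)]
    exact hτ _ _ (by simp) (by simp) (by simp)
  have t3 : θ.1.Rel (Sum.inl b) (Sum.inr ⟨3, by omega⟩) := by
    rw [hθ, relabel_rel, s4, s5]; exact hb
  have t4 : StdLower 4 θ := by
    intro i j hi hj eij
    rw [hθ, relabel_rel, s6 _ (by omega) (by omega), s6 _ (by omega) (by omega)]
    exact hτ i j (by omega) (by omega) (by omega)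
  have u1 : (τ * θ).1.Rel (Sum.inr ⟨0, by omega⟩) (Sum.inr ⟨1, by omega⟩) :=
    mul_rel_inr_inr_of_cup t1 ha t2
  have u2 : (σ * θ).1.Rel (Sum.inr ⟨0, by omega⟩) (Sum.inr ⟨3, by omega⟩) :=
    mul_rel_inr_inr_of_cup t1 hab t3
  have hA01 : A.1.Rel (Sum.inr ⟨0, by omega⟩) (Sum.inr ⟨1, by omega⟩) :=
    hA' _ _ (by simp) (by simp) (by simp)
  have hA4 : StdLower 4 A := fun i j hi hj e => hA' i j (by omega) (by omega) (by omega)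
  have v1 : τ * θ = A := by
    refine eq_of_common (Sum.inr ⟨2, by omega⟩) (Sum.inr ⟨3, by omega⟩) ?_
    rintro (i | i)
    · exact Or.inr (Or.inr ((hτ.mul θ).exists_common (by simpa using he) hA i (by omega)))
    · rcases lt_or_ge i.val 4 with hi | hi
      · obtain ⟨i, hin⟩ := i
        interval_cases i
        · exact Or.inr (Or.inr ⟨_, by simp, u1, hA01⟩)
        · exact Or.inr (Or.inr ⟨_, by simp, u1.symm, hA01.symm⟩)
        · exact Or.inl rfl
        · exact Or.inr (Or.inl rfl)
      · exact Or.inr (Or.inr ((t4.mul τ).exists_common he4 hA4 i hi))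
  have v2 : σ * θ = B := by
    refine eq_of_common (Sum.inr ⟨1, by omega⟩) (Sum.inr ⟨2, by omega⟩) ?_
    rintro (i | i)
    · exact Or.inr (Or.inr ((hσ.mul θ).exists_common (by simpa using he) hB i (by omega)))
    · rcases lt_or_ge i.val 4 with hi | hi
      · obtain ⟨i, hin⟩ := i
        interval_cases i
        · exact Or.inr (Or.inr ⟨_, by simp, u2, hB03⟩)
        · exact Or.inl rfl
        · exact Or.inr (Or.inl rfl)
        · exact Or.inr (Or.inr ⟨_, by simp, u2.symm, hB03.symm⟩)
      · exact Or.inr (Or.inr ((t4.mul σ).exists_common he4 hB' i hi))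
  rw [← v1, ← v2, ← μ.act_mul, ← μ.act_mul, e]

theorem rel_zero_of_stdUpper_one (hn : 0 < n) (he1 : Even (n - 1)) (hA : StdUpper 1 A)
    (hA' : StdLower 1 A) : A.1.Rel (Sum.inl ⟨0, hn⟩) (Sum.inr ⟨0, hn⟩) := by
  obtain ⟨y, hy, h⟩ := A.2.exists_rel (Sum.inl ⟨0, by omega⟩)
  have hy0 : ∀ i : Fin n, y = Sum.inl i ∨ y = Sum.inr i → i.val = 0 := by
    intro i hi
    by_contra h0
    obtain ⟨j, hj, hkj, e⟩ := exists_std_partner he1 i (by omega)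
    rcases hi with rfl | rfl
    · have := A.2.rel_unique (by simpa using hj) (by simpa using hy.symm)
        (hA i j (by omega) hkj e) h.symm
      rw [Sum.inl.inj this] at hkj
      simp at hkj
    · have := A.2.rel_unique (by simpa using hj) (by simp) (hA' i j (by omega) hkj e) h.symm
      simp at this
  rcases y with y | y
  · exact absurd (congrArg Sum.inl (Fin.ext (hy0 y (Or.inl rfl)))) hy
  · rwa [show y = ⟨0, by omega⟩ from Fin.ext (hy0 y (Or.inr rfl))] at h

/-- When the transversals of `σ` and `τ` end at different lower vertices `b` and `c`, a single
multiplication sends these ends to `1` and `0` and makes the rest standard. The products are `B` and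
`A`. -/
theorem act_eq_of_rank_one_of_ne (h3 : 3 ≤ n) (ho : Odd n) (hA : StdUpper 1 A)
    (hA' : StdLower 1 A) (hB : StdUpper 1 B) (hB' : StdLower 3 B)
    (hB01 : B.1.Rel (Sum.inl ⟨0, by omega⟩) (Sum.inr ⟨1, by omega⟩)) {x : X}
    {σ τ : BrauerMonoid n} (hσ : StdUpper 1 σ) (hτ : StdUpper 1 τ) {b c : Fin n} (hbc : b ≠ c)
    (hb : σ.1.Rel (Sum.inl ⟨0, by omega⟩) (Sum.inr b))
    (hc : τ.1.Rel (Sum.inl ⟨0, by omega⟩) (Sum.inr c))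
    (e : μ.act x σ = μ.act x τ) : μ.act x A = μ.act x B := by
  have he1 : Even (n - 1) := Nat.Odd.sub_odd ho odd_one
  have he3 : Even (n - 3) := Nat.Odd.sub_odd ho (by decide)
  obtain ⟨d, hdb, hd⟩ : ∃ d : Fin n, d ≠ b ∧ τ.1.Rel (Sum.inr b) (Sum.inr d) := by
    obtain ⟨y, hy, h⟩ := τ.2.exists_rel (Sum.inr b)
    rcases y with y | y
    · have hy0 := hτ.lt_of_rel_inr he1 h.symm
      rw [show y = ⟨0, by omega⟩ from Fin.ext (by dsimp only; omega)] at h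
      exact absurd (Sum.inr.inj (τ.2.rel_unique (by simp) (by simp) h.symm hc)) hbc
    · exact ⟨y, by simpa using hy, h⟩
  have hdc : d ≠ c := by
    rintro rfl
    have := τ.2.rel_unique (by simp) (by simpa using hdb.symm) hc.symm hd.symm
    simp at this
  -- Cutting the block `{b, d}` of `τ*` open against the lower block `{1, 2}` leads `b` to `1` and
  -- `d` to `2`, while `c` still goes to `0`.
  set s : Equiv.Perm (Fin n ⊕ Fin n) := Equiv.swap (Sum.inl d) (Sum.inr ⟨1, by omega⟩) with hs
  have s1 : ∀ i, i ≠ d → s (Sum.inl i) = Sum.inl i := fun i hi =>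
    Equiv.swap_apply_of_ne_of_ne (by simpa using hi) (by simp)
  have s2 : ∀ i : Fin n, i.val ≠ 1 → s (Sum.inr i) = Sum.inr i := fun i hi =>
    Equiv.swap_apply_of_ne_of_ne (by simp) (by simpa [Fin.ext_iff] using hi)
  set θ : BrauerMonoid n := relabel s (star τ) with hθ
  have t1 : θ.1.Rel (Sum.inl b) (Sum.inr ⟨1, by omega⟩) := by
    rw [hθ, relabel_rel, s1 b hdb.symm, hs, Equiv.swap_apply_right]; exact hd
  have t2 : θ.1.Rel (Sum.inl c) (Sum.inr ⟨0, by omega⟩) := by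
    rw [hθ, relabel_rel, s1 c hdc.symm, s2 _ (by simp)]; exact hc.symm
  have t3 : StdLower 3 θ := by
    intro i j hi hj eij
    rw [hθ, relabel_rel, s2 _ (by omega), s2 _ (by omega)]
    exact hτ i j (by omega) (by omega) (by omega)
  have u1 : (τ * θ).1.Rel (Sum.inl ⟨0, by omega⟩) (Sum.inr ⟨0, by omega⟩) := mul_rel_inl_inr hc t2
  have u2 : (σ * θ).1.Rel (Sum.inl ⟨0, by omega⟩) (Sum.inr ⟨1, by omega⟩) := mul_rel_inl_inr hb t1
  have hA00 := rel_zero_of_stdUpper_one (by omega) he1 hA hA'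
  have hA3 : StdLower 3 A := fun i j hi hj e => hA' i j (by omega) (by omega) (by omega)
  have hzero : ∀ i : Fin n, i.val < 1 → i = ⟨0, by omega⟩ := fun i hi =>
    Fin.ext (by dsimp only; omega)
  have v1 : τ * θ = A := by
    refine eq_of_common (Sum.inr ⟨1, by omega⟩) (Sum.inr ⟨2, by omega⟩) ?_
    rintro (i | i)
    · rcases lt_or_ge i.val 1 with hi | hi
      · rw [hzero i hi]
        exact Or.inr (Or.inr ⟨_, by simp, u1, hA00⟩)
      · exact Or.inr (Or.inr ((hτ.mul θ).exists_common he1 hA i hi))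
    · rcases lt_or_ge i.val 3 with hi | hi
      · obtain ⟨i, hin⟩ := i
        interval_cases i
        · exact Or.inr (Or.inr ⟨_, by simp, u1.symm, hA00.symm⟩)
        · exact Or.inl rfl
        · exact Or.inr (Or.inl rfl)
      · exact Or.inr (Or.inr ((t3.mul τ).exists_common he3 hA3 i hi))
  have v2 : σ * θ = B := by
    refine eq_of_common (Sum.inr ⟨0, by omega⟩) (Sum.inr ⟨2, by omega⟩) ?_
    rintro (i | i)
    · rcases lt_or_ge i.val 1 with hi | hi
      · rw [hzero i hi]
        exact Or.inr (Or.inr ⟨_, by simp, u2, hB01⟩)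
      · exact Or.inr (Or.inr ((hσ.mul θ).exists_common he1 hB i hi))
    · rcases lt_or_ge i.val 3 with hi | hi
      · obtain ⟨i, hin⟩ := i
        interval_cases i
        · exact Or.inl rfl
        · exact Or.inr (Or.inr ⟨_, by simp, u2.symm, hB01.symm⟩)
        · exact Or.inr (Or.inl rfl)
      · exact Or.inr (Or.inr ((t3.mul σ).exists_common he3 hB' i hi))
  rw [← v1, ← v2, ← μ.act_mul, ← μ.act_mul, e]

/-- In rank one, a collapse of two elements yields the collapse of a test pair. -/
theorem act_eq_of_rank_one (h3 : 3 ≤ n) (ho : Odd n) (hA : StdUpper 1 A)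
    (hA' : StdLower 1 A) (hB : StdUpper 1 B) (hB' : StdLower 3 B)
    (hB01 : B.1.Rel (Sum.inl ⟨0, by omega⟩) (Sum.inr ⟨1, by omega⟩)) {x : X}
    {σ τ : BrauerMonoid n} (hσ : InStdRClass 1 σ) (hτ : InStdRClass 1 τ) (hne : σ ≠ τ)
    (e : μ.act x σ = μ.act x τ) : μ.act x A = μ.act x B := by
  have he1 : Even (n - 1) := Nat.Odd.sub_odd ho odd_one
  obtain ⟨p, hp⟩ := hσ.trans ⟨0, by omega⟩ (by simp)
  obtain ⟨q, hq⟩ := hτ.trans ⟨0, by omega⟩ (by simp)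
  by_cases hpq : p = q
  swap
  · exact act_eq_of_rank_one_of_ne h3 ho hA hA' hB hB' hB01 hσ.std hτ.std hpq hp hq e
  subst hpq
  have hlow : ∀ (α : BrauerMonoid n), StdUpper 1 α → α.1.Rel (Sum.inl ⟨0, by omega⟩) (Sum.inr p) →
      ∀ a : Fin n, a ≠ p → ∃ b : Fin n, b ≠ a ∧ b ≠ p ∧ α.1.Rel (Sum.inr a) (Sum.inr b) := by
    intro α hα hp a hap
    obtain ⟨y, hy, h⟩ := α.2.exists_rel (Sum.inr a)
    rcases y with y | y
    · have hy0 := hα.lt_of_rel_inr he1 h.symm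
      rw [show y = ⟨0, by omega⟩ from Fin.ext (by dsimp only; omega)] at h
      exact absurd (Sum.inr.inj (α.2.rel_unique (by simp) (by simp) h.symm hp)) hap
    · refine ⟨y, by simpa using hy, ?_, h⟩
      rintro rfl
      have := α.2.rel_unique (by simp) (by simpa using hap) hp.symm h.symm
      simp at this
  obtain ⟨a, b, hap, hbp, hba, hab, hno⟩ : ∃ a b : Fin n, a ≠ p ∧ b ≠ p ∧ b ≠ a ∧
      σ.1.Rel (Sum.inr a) (Sum.inr b) ∧ ¬ τ.1.Rel (Sum.inr a) (Sum.inr b) := by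
    by_contra hcon
    push Not at hcon
    refine hne (eq_of_common (Sum.inl ⟨0, by omega⟩) (Sum.inr p) ?_)
    rintro (i | i)
    · rcases lt_or_ge i.val 1 with hi | hi
      · exact Or.inl (congrArg Sum.inl (Fin.ext (by dsimp only; omega)))
      · exact Or.inr (Or.inr (hσ.std.exists_common he1 hτ.std i hi))
    · by_cases hi : i = p
      · exact Or.inr (Or.inl (congrArg Sum.inr hi))
      · obtain ⟨j, hj, hjp, h⟩ := hlow σ hσ.std hp i hi
        exact Or.inr (Or.inr ⟨Sum.inr j, by simpa using hj, h, hcon _ _ hi hjp hj h⟩)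
  obtain ⟨d, hda, hdp, hd⟩ := hlow τ hτ.std hq a hap
  have hbd : b ≠ d := by rintro rfl; exact hno hd
  -- If both transversals end at `p`, the element `ω` with the upper block `{p, a}` and vertical
  -- lines away from `p` and `a` diverts them through `a` to its partner, which is `b` in `σ` and
  -- `d` in `τ`. This reduces to transversals with different ends.
  set s : Equiv.Perm (Fin n ⊕ Fin n) := Equiv.swap (Sum.inr p) (Sum.inl a) with hs
  set ω : BrauerMonoid n := relabel s 1 with hω
  have s1 : ∀ i, i ≠ a → s (Sum.inl i) = Sum.inl i := fun i hi =>
    Equiv.swap_apply_of_ne_of_ne (by simp) (by simpa using hi)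
  have t1 : ω.1.Rel (Sum.inl p) (Sum.inl a) := by
    rw [hω, relabel_rel, s1 p hap.symm, hs, Equiv.swap_apply_right]
    exact rel_one_of
  have t2 : ∀ i, i ≠ a → i ≠ p → ω.1.Rel (Sum.inl i) (Sum.inr i) := by
    intro i hi hip
    rw [hω, relabel_rel, s1 i hi, hs,
      Equiv.swap_apply_of_ne_of_ne (by simpa using hip) (by simp)]
    exact rel_one_of
  have key : ∀ (α : BrauerMonoid n) (v : Fin n), α.1.Rel (Sum.inl ⟨0, by omega⟩) (Sum.inr p) →
      α.1.Rel (Sum.inr a) (Sum.inr v) → v ≠ a → v ≠ p →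
      (α * ω).1.Rel (Sum.inl ⟨0, by omega⟩) (Sum.inr v) := fun α v hαp hαv hva hvp =>
    (mul_rel _ _ _ _).2 ((((conn_top_mid hαp).trans (conn_mid_mid t1)).trans
      (conn_mid_top hαv)).trans (conn_mid_bot (t2 v hva hvp)))
  exact act_eq_of_rank_one_of_ne h3 ho hA hA' hB hB' hB01 (hσ.std.mul ω) (hτ.std.mul ω) hbd
    (key σ b hp hab hba hbp) (key τ d hq hd hda hdp) (by rw [← μ.act_mul, ← μ.act_mul, e])

/-- No group is needed in the bottom rank: `x` separates all normal forms by hypothesis, and a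
normal form retains the lower blocks, which determine the projection. -/
theorem ncard_projectionOrbit_bot {x : X}
    (h : ∀ σ τ : BrauerMonoid n, InStdRClass k σ → InStdRClass k τ → μ.act x σ = μ.act x τ →
      σ = τ) : (μ.projectionOrbit x ⊥ k).ncard = numProjections n k := by
  rw [projectionOrbit_eq_image, Set.InjOn.ncard_image, Set.ncard_prod, numProjections]
  · simp
  · rintro ⟨ξ, ε⟩ ⟨hξ, hε⟩ ⟨η, δ⟩ ⟨hη, hδ⟩ e
    obtain rfl : ξ = 1 := by simpa using hξ
    obtain rfl : η = 1 := by simpa using hη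
    dsimp only at hε hδ e
    rw [perm_one, one_mul, one_mul] at e
    have h1 := h _ _ (overline_projection hε) (overline_projection hδ) e
    rw [projections_ext hε hδ fun a b => by
      rw [← overline_rel_inr_inr ε, ← overline_rel_inr_inr δ, h1]]

theorem exists_overline_of_mem_projectionOrbit_bot {x y : X} (h : y ∈ μ.projectionOrbit x ⊥ k) :
    ∃ ω : BrauerMonoid n, StdUpper k ω ∧ y = μ.act x ω := by
  obtain ⟨ξ, hξ, ε, hε, rfl⟩ := h
  obtain rfl : ξ = 1 := by simpa using hξ
  exact ⟨_, (overline_projection hε).std, by rw [perm_one, one_mul]⟩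

/-- The points `y A` cannot all lie in the orbit of rank zero or one. -/
theorem IsTestPair.exists_act_notMem {l : ℕ} {c : Equiv.Perm (Fin n)} (h : IsTestPair k c A B)
    {x : X} (hx : μ.Witnesses x A B) (hl : Even (n - l)) (hl1 : l ≤ 1)
    (hA : StdUpper l A) (hA' : StdLower l A) (x₀ : X) :
    ∃ y, μ.act y A ∉ μ.projectionOrbit x₀ ⊥ l := by
  by_contra hcon
  push Not at hcon
  have hn : 0 < n := lt_of_lt_of_le (by have := h.two_le; omega) h.le
  -- The element `A` absorbs everything with standard upper row on its left, so `yA = yAA = x₀ωA =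
  -- x₀A`. Thus `A` acts as a constant map, and so does `B`, with the same value.
  have key : ∀ y, μ.act y A = μ.act x₀ A := by
    intro y
    obtain ⟨ω, hω, e⟩ := exists_overline_of_mem_projectionOrbit_bot (hcon y)
    have h1 : ∀ ω : BrauerMonoid n, StdUpper l ω → ω * A = A := fun ω hω =>
      eq_of_stdUpper_of_stdLower hn hl hl1 (hω.mul A) (hA'.mul ω) hA hA'
    conv_lhs => rw [← h1 A hA]
    rw [← μ.act_mul, e, μ.act_mul, h1 ω hω]
  apply hx
  have hB : B = perm c⁻¹ * A := by
    rw [← h.perm_mul, ← mul_assoc, perm_mul_perm, mul_inv_cancel, perm_one, one_mul]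
  rw [hB, ← μ.act_mul, key x, key (μ.act x _)]

end BrauerMonoid

/-! ### Degrees, cardinalities and small cyclic groups -/

/-- An embedding into self-maps is the same as a faithful action on `Fin m`. The right regular
representation must be supplied as well: the infimum of the empty set is `0`, which would make the
bound fail. -/
theorem le_transformationDegree {S : Type*} [Monoid S] [Finite S] {N : ℕ}
    (h : ∀ (m : ℕ) (μ : RightAction S (Fin m)), μ.IsFaithful → N ≤ m) :
    N ≤ transformationDegree S := by
  refine le_csInf ?_ ?_
  · obtain ⟨m, ⟨e⟩⟩ := Finite.exists_equiv_fin S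
    refine ⟨m, ?_, ⟨fun s => MulOpposite.op fun i => e (e.symm i * s), fun s t => ?_⟩, fun s t hst => ?_⟩
    · exact Nat.one_le_iff_ne_zero.2 (by rintro rfl; exact (e 1).elim0)
    · apply MulOpposite.unop_injective
      funext i
      change e (e.symm i * (s * t)) = e (e.symm (e (e.symm i * s)) * t)
      rw [e.symm_apply_apply, mul_assoc]
    -- Evaluation at the identity recovers the element.
    · have h1 := congrFun (MulOpposite.op_injective hst) (e 1)
      simpa using h1
  · rintro m ⟨-, φ, hφ⟩
    refine h m ⟨fun x a => (φ a).unop x, fun x a b => ?_⟩ fun a b hab => ?_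
    · rw [map_mul]
      rfl
    · exact hφ (MulOpposite.unop_injective (funext hab))

theorem Set.ncard_add_one_le_card {X : Type*} {S : Set X} (hf : S.Finite) (hne : S ≠ Set.univ) :
    ((S.ncard + 1 : ℕ) : ℕ∞) ≤ ENat.card X := by
  obtain ⟨y, hy⟩ := (Set.ne_univ_iff_exists_notMem S).1 hne
  have h1 := Set.encard_insert_of_notMem hy
  rw [← hf.cast_ncard_eq] at h1
  push_cast
  rw [← h1, ← Set.encard_univ]
  exact Set.encard_le_encard (Set.subset_univ _)

theorem Subgroup.eq_of_mem_zpowers_of_orderOf {G : Type*} [Group G] {c : G}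
    (hc : orderOf c = 2 ∨ orderOf c = 3) {g : G} (hg : g ∈ Subgroup.zpowers c) :
    g = 1 ∨ g = c ∨ g⁻¹ = c := by
  obtain ⟨m, rfl⟩ := hg
  dsimp only
  rw [← zpow_mod_orderOf]
  have h0 : 0 ≤ m % (orderOf c : ℤ) := Int.emod_nonneg _ (by omega)
  have h1 : m % (orderOf c : ℤ) < orderOf c := Int.emod_lt_of_pos _ (by omega)
  have h2 : m % (orderOf c : ℤ) = 0 ∨ m % (orderOf c : ℤ) = 1 ∨
      (m % (orderOf c : ℤ) = 2 ∧ orderOf c = 3) := by omega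
  rcases h2 with h2 | h2 | ⟨h2, h3⟩
  · left; rw [h2, zpow_zero]
  · right; left; rw [h2, zpow_one]
  · right; right
    rw [h2, inv_eq_iff_mul_eq_one, zpow_ofNat, ← pow_succ]
    have h4 := pow_orderOf_eq_one c
    rwa [h3] at h4

/-! ### The concrete test pairs -/

namespace BrauerMonoid

open PartitionMonoid

variable {n : ℕ}

instance : Finite (BrauerMonoid n) := by
  have : Finite (PartitionMonoid n) :=
    Finite.of_injective (fun α : PartitionMonoid n => α.Rel) fun α β h =>
      PartitionMonoid.ext_rel fun x y => by
        have := congrFun (congrFun h x) y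
        exact iff_of_eq this
  exact Subtype.finite

/-- The cycle `(1, 2, 3)`. -/
def threeCycle (h3 : 3 ≤ n) : Equiv.Perm (Fin n) :=
  List.formPerm [⟨0, by omega⟩, ⟨1, by omega⟩, ⟨2, by omega⟩]

theorem threeCycle_eq (h3 : 3 ≤ n) : threeCycle h3 =
    Equiv.swap ⟨0, by omega⟩ ⟨1, by omega⟩ * Equiv.swap ⟨1, by omega⟩ ⟨2, by omega⟩ := by
  simp [threeCycle]

theorem threeCycle_val (h3 : 3 ≤ n) (i : Fin n) : (threeCycle h3 i).val =
    if i.val = 0 then 1 else if i.val = 1 then 2 else if i.val = 2 then 0 else i.val := by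
  rw [threeCycle_eq, Equiv.Perm.mul_apply]
  simp only [Equiv.swap_apply_def, Fin.ext_iff]
  split_ifs <;> simp_all

theorem orderOf_threeCycle (h3 : 3 ≤ n) : orderOf (threeCycle h3) = 3 := by
  rw [threeCycle_eq, Equiv.swap_comm]
  exact (Equiv.Perm.isThreeCycle_swap_mul_swap_same (by simp) (by simp) (by simp)).orderOf

theorem zeta_stdUpper (h4 : 4 ≤ n) (he : Even n) : StdUpper 0 (zeta h4 he) := by
  intro i j _ _ e
  change (Sum.inl (nested0 i) : ℕ ⊕ ℕ) = Sum.inl (nested0 j)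
  simpa [nested0] using e

theorem zeta_stdLower (h4 : 4 ≤ n) (he : Even n) : StdLower 0 (zeta h4 he) := by
  intro i j _ _ e
  change (Sum.inr (nested0 i) : ℕ ⊕ ℕ) = Sum.inr (nested0 j)
  simpa [nested0] using e

theorem nested1_eq_of_four_le {i j : Fin n} (hi : 4 ≤ i.val) (hj : 4 ≤ j.val)
    (e : (i.val - 4) / 2 = (j.val - 4) / 2) : nested1 i = nested1 j := by
  simp only [nested1]
  split_ifs <;> omega

theorem alpha_stdUpper (h4 : 4 ≤ n) (he : Even n) : StdUpper 4 (alpha h4 he) := by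
  intro i j hi hj e
  exact congrArg Sum.inl (nested1_eq_of_four_le hi hj e)

theorem alpha_stdLower (h4 : 4 ≤ n) (he : Even n) : StdLower 0 (alpha h4 he) := by
  intro i j _ _ e
  change (Sum.inr (nested0 i) : ℕ ⊕ ℕ) = Sum.inr (nested0 j)
  simpa [nested0] using e

theorem beta_stdUpper (h4 : 4 ≤ n) (he : Even n) : StdUpper 0 (beta h4 he) := by
  intro i j _ _ e
  change (Sum.inl (nested0 i) : ℕ ⊕ ℕ) = Sum.inl (nested0 j)
  simpa [nested0] using e

theorem beta_stdLower (h4 : 4 ≤ n) (he : Even n) : StdLower 4 (beta h4 he) := by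
  intro i j hi hj e
  exact congrArg Sum.inr (nested1_eq_of_four_le hi hj e)

theorem beta_rel (h4 : 4 ≤ n) (he : Even n) :
    (beta h4 he).1.Rel (Sum.inr ⟨0, by omega⟩) (Sum.inr ⟨3, by omega⟩) := rfl

theorem gamma_stdLower (h4 : 4 ≤ n) (he : Even n) : StdLower 2 (gamma h4 he) := by
  intro i j hi hj e
  simp only [gamma, twoLines, ofLabel_rel, Sum.elim_inr]
  rw [if_neg (by omega), if_neg (by omega), Prod.mk.injEq]
  omega

theorem delta_stdLower (h4 : 4 ≤ n) (he : Even n) : StdLower 2 (delta h4 he) := by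
  intro i j hi hj e
  simp only [delta, twoLines, ofLabel_rel, Sum.elim_inr]
  rw [if_neg (by omega), if_neg (by omega), Prod.mk.injEq]
  omega

theorem delta_stdUpper (h4 : 4 ≤ n) (he : Even n) : StdUpper 2 (delta h4 he) := by
  intro i j hi hj e
  simp only [delta, twoLines, ofLabel_rel, Sum.elim_inl]
  rw [if_neg (by omega), if_neg (by omega), Prod.mk.injEq]
  omega

theorem zeta_ne_beta (h4 : 4 ≤ n) (he : Even n) : zeta h4 he ≠ beta h4 he := by
  intro e
  have h := beta_rel h4 he
  rw [← e] at h
  have h' : (Sum.inr (0 / 2) : ℕ ⊕ ℕ) = Sum.inr (3 / 2) := h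
  simp at h'

theorem zeta_ne_alpha (h4 : 4 ≤ n) (he : Even n) : zeta h4 he ≠ alpha h4 he := by
  intro e
  have h : (alpha h4 he).1.Rel (Sum.inl ⟨0, by omega⟩) (Sum.inl ⟨3, by omega⟩) := rfl
  rw [← e] at h
  have h' : (Sum.inl (0 / 2) : ℕ ⊕ ℕ) = Sum.inl (3 / 2) := h
  simp at h'

theorem gamma_ne_delta (h4 : 4 ≤ n) (he : Even n) : gamma h4 he ≠ delta h4 he := by
  intro e
  have h : (gamma h4 he).1.Rel (Sum.inl ⟨0, by omega⟩) (Sum.inr ⟨0, by omega⟩) := rfl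
  rw [e] at h
  have h' : ((0, 1 - 0) : ℕ × ℕ) = (0, 0) := h
  simp at h'

/-- The swap of `0` and `1` exchanges the two transversals. If `{0, 1}` is an upper block of `ω`,
both products have it as well, and they share all other blocks off the lower vertices `0` and `1`,
which must then be joined. -/
theorem isTestPair_gamma_delta (h4 : 4 ≤ n) (he : Even n) :
    IsTestPair 2 (Equiv.swap (⟨0, by omega⟩ : Fin n) ⟨1, by omega⟩) (gamma h4 he)
      (delta h4 he) where
  two_le := le_rfl
  le := by omega
  even := (Nat.even_sub (by omega)).2 (by simp [he])
  fix i hi := Equiv.swap_apply_of_ne_of_ne (by simp [Fin.ext_iff]; omega)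
    (by simp [Fin.ext_iff]; omega)
  perm_mul := by
    refine ext_rel' fun x y => ?_
    rw [perm_mul_rel]
    have key : ∀ x : Fin n ⊕ Fin n, (Sum.elim
        (fun i => if i.val < 2 then (0, 1 - i.val) else (1, i.val / 2))
        (fun j => if j.val < 2 then ((0, j.val) : ℕ × ℕ) else (2, j.val / 2)))
        (Sum.map (Equiv.swap (⟨0, by omega⟩ : Fin n) ⟨1, by omega⟩) id x) = (Sum.elim
        (fun i => if i.val < 2 then (0, i.val) else (1, i.val / 2))
        (fun j => if j.val < 2 then ((0, j.val) : ℕ × ℕ) else (2, j.val / 2))) x := by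
      rintro (⟨i, hi⟩ | i)
      · rcases lt_or_ge i 2 with h | h
        · interval_cases i <;> simp
        · rw [Sum.map_inl, Equiv.swap_apply_of_ne_of_ne (by simp; omega) (by simp; omega)]
          simp [show ¬ i ≤ 1 by omega]
      · rfl
    simp only [gamma, delta, twoLines, ofLabel_rel, key]
  std := delta_stdUpper h4 he
  collapse ω hω hc := by
    obtain ⟨i, j, hij, hi, hj, hr⟩ := hc
    have he2 : Even (n - 2) := (Nat.even_sub (by omega)).2 (by simp [he])
    refine eq_of_common (Sum.inr ⟨0, by omega⟩) (Sum.inr ⟨1, by omega⟩) ?_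
    rintro (l | l)
    · right; right
      rcases lt_or_ge l.val 2 with hl | hl
      · have hl' : l = i ∨ l = j := by
          simp only [Fin.ext_iff] at hij ⊢
          omega
        rcases hl' with rfl | rfl
        · exact ⟨Sum.inl j, by simpa using hij.symm, mul_rel_inl_inl hr, mul_rel_inl_inl hr⟩
        · exact ⟨Sum.inl i, by simpa using hij, mul_rel_inl_inl hr.symm, mul_rel_inl_inl hr.symm⟩
      · exact (hω.mul _).exists_common he2 (hω.mul _) l hl
    · rcases lt_or_ge l.val 2 with hl | hl
      · simp only [Sum.inr.injEq, Fin.ext_iff]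
        omega
      · exact Or.inr (Or.inr (((gamma_stdLower h4 he).mul ω).exists_common he2
          ((delta_stdLower h4 he).mul ω) l hl))
  zpowers g hg := Subgroup.eq_of_mem_zpowers_of_orderOf
    (Or.inl (Equiv.Perm.IsSwap.orderOf ⟨_, _, by simp, rfl⟩)) hg

/-- The three-cycle permutes the three pairings of four points, which accounts for the factor 3.
Once one block inside the first four upper vertices is fixed, the complementary block is forced, so
`ωζ = ωα`. -/
theorem isTestPair_zeta_alpha (h4 : 4 ≤ n) (he : Even n) :
    IsTestPair 4 (threeCycle (n := n) (by omega)) (zeta h4 he) (alpha h4 he) where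
  two_le := by omega
  le := h4
  even := (Nat.even_sub h4).2 (by simp [he, show Even 4 by decide])
  fix i hi := by
    rw [Fin.ext_iff, threeCycle_val]
    split_ifs <;> omega
  perm_mul := by
    refine eq_of_stdUpper_of_stdLower (k := 0) (by omega) (by simpa using he) (by omega) ?_
      ((alpha_stdLower h4 he).mul _) (zeta_stdUpper h4 he) (zeta_stdLower h4 he)
    intro i j _ _ e
    rw [perm_mul_rel]
    refine congrArg Sum.inl ?_
    have key : ∀ i : Fin n, nested1 (threeCycle (n := n) (by omega) i) =
        if i.val < 2 then 1 else if i.val < 4 then 0 else i.val / 2 := by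
      intro i
      simp only [nested1, threeCycle_val]
      rcases lt_or_ge i.val 4 with hi | hi
      · interval_cases i.val <;> simp
      · simp [show i.val ≠ 0 by omega, show i.val ≠ 1 by omega, show i.val ≠ 2 by omega,
          show i.val ≠ 3 by omega, show ¬ i.val < 2 by omega, show ¬ i.val < 4 by omega]
    rw [key, key]
    split_ifs <;> omega
  std := alpha_stdUpper h4 he
  collapse ω hω hc := by
    obtain ⟨i, j, hij, hi, hj, hr⟩ := hc
    have he4 : Even (n - 4) := (Nat.even_sub h4).2 (by simp [he, show Even 4 by decide])
    have hF : ∀ i j : Fin 4, i ≠ j → ∃ p q : Fin 4, ∀ l, l = i ∨ l = j ∨ l = p ∨ l = q := by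
      decide
    obtain ⟨p, q, hpq⟩ := hF ⟨i, hi⟩ ⟨j, hj⟩ (by simpa [Fin.ext_iff] using hij)
    refine eq_of_common (Sum.inl (p.castLE h4)) (Sum.inl (q.castLE h4)) ?_
    rintro (l | l)
    · rcases lt_or_ge l.val 4 with hl | hl
      · have hl' := hpq ⟨l, hl⟩
        simp only [Fin.ext_iff] at hl'
        rcases hl' with h | h | h | h
        · obtain rfl := Fin.ext h
          exact Or.inr (Or.inr
            ⟨Sum.inl j, by simpa using hij.symm, mul_rel_inl_inl hr, mul_rel_inl_inl hr⟩)
        · obtain rfl := Fin.ext h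
          exact Or.inr (Or.inr
            ⟨Sum.inl i, by simpa using hij, mul_rel_inl_inl hr.symm, mul_rel_inl_inl hr.symm⟩)
        · exact Or.inl (congrArg Sum.inl (Fin.ext h))
        · exact Or.inr (Or.inl (congrArg Sum.inl (Fin.ext h)))
      · exact Or.inr (Or.inr ((hω.mul _).exists_common he4 (hω.mul _) l hl))
    · exact Or.inr (Or.inr (((zeta_stdLower h4 he).mul ω).exists_common (by simpa using he)
          ((alpha_stdLower h4 he).mul ω) l (by omega)))
  zpowers g hg := Subgroup.eq_of_mem_zpowers_of_orderOf (Or.inr (orderOf_threeCycle _)) hg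

/-- In odd degree there is an element of rank one with standard upper and lower row. -/
theorem exists_stdUpper_one_stdLower_one (ho : Odd n) :
    ∃ A : BrauerMonoid n, StdUpper 1 A ∧ StdLower 1 A := by
  have he1 : Even (n - 1) := Nat.Odd.sub_odd ho odd_one
  have hn : 0 < n := ho.pos
  -- The first coordinate is `0` for the transversal, `1` for the upper blocks and `2` for the lower
  -- blocks.
  let f : Fin n ⊕ Fin n → ℕ × ℕ := Sum.elim
    (fun i => if i.val = 0 then (0, 0) else (1, (i.val - 1) / 2))
    (fun i => if i.val = 0 then (0, 0) else (2, (i.val - 1) / 2))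
  have hfl : ∀ i : Fin n, f (Sum.inl i) = if i.val = 0 then (0, 0) else (1, (i.val - 1) / 2) :=
    fun _ => rfl
  have hfr : ∀ i : Fin n, f (Sum.inr i) = if i.val = 0 then (0, 0) else (2, (i.val - 1) / 2) :=
    fun _ => rfl
  have hB : (ofLabel f).IsBrauer := by
    rw [isBrauer_iff]
    rintro (i | i)
    · by_cases hi : i.val = 0
      · refine ⟨Sum.inr i, by simp, ?_⟩
        rintro (z | z)
        · rw [ofLabel_rel, hfl, hfl, if_pos hi]
          split_ifs <;> simp [Fin.ext_iff] <;> omega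
        · rw [ofLabel_rel, hfr, hfl, if_pos hi]
          split_ifs <;> simp [Fin.ext_iff] <;> omega
      · refine ⟨Sum.inl ⟨if (i.val - 1) % 2 = 0 then i.val + 1 else i.val - 1, ?_⟩, ?_, ?_⟩
        · have := i.isLt
          obtain ⟨m, hm⟩ := he1
          split_ifs <;> omega
        · rw [Ne, Sum.inl.injEq, Fin.ext_iff]
          dsimp only
          split_ifs <;> omega
        · rintro (z | z)
          · rw [ofLabel_rel, hfl, hfl, if_neg hi, Sum.inl.injEq, Sum.inl.injEq, Fin.ext_iff,
              Fin.ext_iff]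
            dsimp only
            split_ifs <;> simp only [Prod.mk.injEq, true_and, zero_ne_one, false_and, false_iff] <;> omega
          · rw [ofLabel_rel, hfr, hfl, if_neg hi]
            split_ifs <;> simp
    · by_cases hi : i.val = 0
      · refine ⟨Sum.inl i, by simp, ?_⟩
        rintro (z | z)
        · rw [ofLabel_rel, hfl, hfr, if_pos hi]
          split_ifs <;> simp [Fin.ext_iff] <;> omega
        · rw [ofLabel_rel, hfr, hfr, if_pos hi]
          split_ifs <;> simp [Fin.ext_iff] <;> omega
      · refine ⟨Sum.inr ⟨if (i.val - 1) % 2 = 0 then i.val + 1 else i.val - 1, ?_⟩, ?_, ?_⟩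
        · have := i.isLt
          obtain ⟨m, hm⟩ := he1
          split_ifs <;> omega
        · rw [Ne, Sum.inr.injEq, Fin.ext_iff]
          dsimp only
          split_ifs <;> omega
        · rintro (z | z)
          · rw [ofLabel_rel, hfl, hfr, if_neg hi]
            split_ifs <;> simp
          · rw [ofLabel_rel, hfr, hfr, if_neg hi, Sum.inr.injEq, Sum.inr.injEq, Fin.ext_iff,
              Fin.ext_iff]
            dsimp only
            split_ifs <;> simp only [Prod.mk.injEq, true_and, OfNat.zero_ne_ofNat, false_and, false_iff] <;> omega
  refine ⟨⟨ofLabel f, hB⟩, fun i j hi hj e => ?_, fun i j hi hj e => ?_⟩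
  · change f _ = f _
    rw [hfl, hfl, if_neg (by omega), if_neg (by omega), e]
  · change f _ = f _
    rw [hfr, hfr, if_neg (by omega), if_neg (by omega), e]

/-- For rank-one `A` with standard rows, the three-cycle moves the upper end of the transversal
among the first three vertices. If `ω` joins two of these three, the third is left as the only
possible upper end, so both products coincide. -/
theorem isTestPair_three (h3 : 3 ≤ n) (ho : Odd n) {A : BrauerMonoid n} (hA : StdUpper 1 A)
    (hA' : StdLower 1 A) :
    IsTestPair 3 (threeCycle h3) A (perm (threeCycle h3)⁻¹ * A) where
  two_le := by omega
  le := h3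
  even := Nat.Odd.sub_odd ho (by decide)
  fix i hi := by
    rw [Fin.ext_iff, threeCycle_val]
    split_ifs <;> omega
  perm_mul := by rw [← mul_assoc, perm_mul_perm, inv_mul_cancel, perm_one, one_mul]
  std := by
    refine StdUpper.perm_mul (fun i j hi hj e => hA i j (by omega) (by omega) (by omega)) ?_
    intro i hi
    rw [Equiv.Perm.inv_eq_iff_eq, Fin.ext_iff, threeCycle_val]
    split_ifs <;> omega
  collapse ω hω hc := by
    obtain ⟨i, j, hij, hi, hj, hr⟩ := hc
    have he3 : Even (n - 3) := Nat.Odd.sub_odd ho (by decide)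
    have he1 : Even (n - 1) := Nat.Odd.sub_odd ho odd_one
    have hF : ∀ i j : Fin 3, i ≠ j → ∃ p : Fin 3, ∀ l, l = i ∨ l = j ∨ l = p := by
      decide
    obtain ⟨p, hp⟩ := hF ⟨i, hi⟩ ⟨j, hj⟩ (by simpa [Fin.ext_iff] using hij)
    refine eq_of_common (Sum.inl (p.castLE h3)) (Sum.inr ⟨0, by omega⟩) ?_
    rintro (l | l)
    · rcases lt_or_ge l.val 3 with hl | hl
      · have hl' := hp ⟨l, hl⟩
        simp only [Fin.ext_iff] at hl'
        rcases hl' with h | h | h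
        · obtain rfl := Fin.ext h
          exact Or.inr (Or.inr
            ⟨Sum.inl j, by simpa using hij.symm, mul_rel_inl_inl hr, mul_rel_inl_inl hr⟩)
        · obtain rfl := Fin.ext h
          exact Or.inr (Or.inr
            ⟨Sum.inl i, by simpa using hij, mul_rel_inl_inl hr.symm, mul_rel_inl_inl hr.symm⟩)
        · exact Or.inl (congrArg Sum.inl (Fin.ext h))
      · exact Or.inr (Or.inr ((hω.mul _).exists_common he3 (hω.mul _) l hl))
    · rcases lt_or_ge l.val 1 with hl | hl
      · exact Or.inr (Or.inl (congrArg Sum.inr (Fin.ext (by dsimp only; omega))))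
      · exact Or.inr (Or.inr ((hA'.mul ω).exists_common he1 ((hA'.mul _).mul ω) l hl))
  zpowers g hg := Subgroup.eq_of_mem_zpowers_of_orderOf (Or.inr (orderOf_threeCycle _)) hg

/-! ### Assembling the orbits -/

theorem finite_projectionOrbit {X : Type*} (μ : RightAction (BrauerMonoid n) X) (x : X)
    (C : Subgroup (Equiv.Perm (Fin n))) (r : ℕ) : (μ.projectionOrbit x C r).Finite := by
  rw [projectionOrbit_eq_image]
  exact (Set.toFinite _).image _

theorem exists_witnesses {X : Type*} {μ : RightAction (BrauerMonoid n) X} (hμ : μ.IsFaithful)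
    {a b : BrauerMonoid n} (hab : a ≠ b) : ∃ x, μ.Witnesses x a b := by
  by_contra hcon
  push Not at hcon
  exact hab (hμ a b fun x => not_not.1 (hcon x))

theorem IsTestPair.disjoint_projectionOrbit {X : Type*} {μ : RightAction (BrauerMonoid n) X}
    {k l : ℕ} {c : Equiv.Perm (Fin n)} {A B : BrauerMonoid n} (h : IsTestPair k c A B) {x : X}
    (hx : μ.Witnesses x A B) (hl : l < k) (hlk : Even (k - l)) {C : Subgroup (Equiv.Perm (Fin n))}
    (hC : ∀ ξ ∈ C, ∀ i : Fin n, l ≤ i.val → ξ i = i) (y : X) :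
    Disjoint (μ.projectionOrbit y C l) (μ.projectionOrbit x (Subgroup.zpowers c) k) := by
  rw [Set.disjoint_left]
  rintro _ ⟨ξ, hξ, ε, hε, rfl⟩
  exact h.act_notMem hx hl hlk ((overline_projection hε).std.perm_mul (hC ξ hξ)) y

theorem projectionOrbits_even (h4 : 4 ≤ n) (he : Even n) {X : Type*}
    (μ : RightAction (BrauerMonoid n) X) (x₀ x₂ x₄ : X)
    (h₀ : μ.Witnesses x₀ (zeta h4 he) (beta h4 he))
    (h₂ : μ.Witnesses x₂ (gamma h4 he) (delta h4 he))
    (h₄ : μ.Witnesses x₄ (zeta h4 he) (alpha h4 he)) :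
    (μ.projectionOrbit x₀ ⊥ 0).ncard = numProjections n 0 ∧
    (μ.projectionOrbit x₂ (cyclic2 h4) 2).ncard = 2 * numProjections n 2 ∧
    (μ.projectionOrbit x₄ (cyclic3 h4) 4).ncard = 3 * numProjections n 4 ∧
    Disjoint (μ.projectionOrbit x₀ ⊥ 0) (μ.projectionOrbit x₂ (cyclic2 h4) 2) ∧
    Disjoint (μ.projectionOrbit x₀ ⊥ 0) (μ.projectionOrbit x₄ (cyclic3 h4) 4) ∧
    Disjoint (μ.projectionOrbit x₂ (cyclic2 h4) 2) (μ.projectionOrbit x₄ (cyclic3 h4) 4) ∧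
    μ.projectionOrbit x₀ ⊥ 0 ∪ μ.projectionOrbit x₂ (cyclic2 h4) 2
      ∪ μ.projectionOrbit x₄ (cyclic3 h4) 4 ≠ Set.univ := by
  have t2 := isTestPair_gamma_delta h4 he
  have t4 := isTestPair_zeta_alpha h4 he
  have hbot : ∀ ξ ∈ (⊥ : Subgroup (Equiv.Perm (Fin n))), ∀ i : Fin n, 0 ≤ i.val → ξ i = i := by
    intro ξ hξ i _
    rw [Subgroup.mem_bot.1 hξ]
    rfl
  have hzu := zeta_stdUpper h4 he
  refine ⟨?_, ?_, ?_, ?_, ?_, ?_, ?_⟩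
  · refine ncard_projectionOrbit_bot fun σ τ hσ hτ e => ?_
    by_contra hne
    exact h₀ (act_eq_of_rank_zero h4 he hzu (zeta_stdLower h4 he) (beta_stdUpper h4 he)
      (beta_stdLower h4 he) (beta_rel h4 he) hσ.std hτ.std hne e)
  · have := t2.ncard_projectionOrbit h₂
    rwa [Equiv.Perm.IsSwap.orderOf ⟨_, _, by simp, rfl⟩] at this
  · have := t4.ncard_projectionOrbit h₄
    rwa [orderOf_threeCycle] at this
  · exact t2.disjoint_projectionOrbit h₂ (by omega) (by decide) hbot x₀
  · exact t4.disjoint_projectionOrbit h₄ (by omega) (by decide) hbot x₀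
  · exact t4.disjoint_projectionOrbit h₄ (by omega) (by decide) (fun ξ hξ => t2.fix_of_mem hξ) x₂
  · intro hU
    -- The point outside all three orbits is some `yζ`: having rank zero, `ζ` keeps it out of the
    -- two higher orbits for every `y`.
    obtain ⟨y, hy⟩ := t4.exists_act_notMem h₄ (l := 0) (by simpa using he) (by omega) hzu
      (zeta_stdLower h4 he) x₀
    have h1 : μ.act y (zeta h4 he) ∈ (Set.univ : Set X) := trivial
    rw [← hU] at h1
    rcases h1 with (h1 | h1) | h1
    · exact hy h1
    · exact t2.act_notMem h₂ (l := 0) (by omega) (by decide) hzu y h1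
    · exact t4.act_notMem h₄ (l := 0) (by omega) (by decide) hzu y h1

theorem exists_witnesses_even (h4 : 4 ≤ n) (he : Even n) {X : Type*}
    {μ : RightAction (BrauerMonoid n) X} (hμ : μ.IsFaithful) : ∃ x₀ x₂ x₄ : X,
      μ.Witnesses x₀ (zeta h4 he) (beta h4 he) ∧ μ.Witnesses x₂ (gamma h4 he) (delta h4 he) ∧
      μ.Witnesses x₄ (zeta h4 he) (alpha h4 he) := by
  obtain ⟨x₀, h₀⟩ := exists_witnesses hμ (zeta_ne_beta h4 he)
  obtain ⟨x₂, h₂⟩ := exists_witnesses hμ (gamma_ne_delta h4 he)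
  obtain ⟨x₄, h₄⟩ := exists_witnesses hμ (zeta_ne_alpha h4 he)
  exact ⟨x₀, x₂, x₄, h₀, h₂, h₄⟩

theorem le_card_even (h4 : 4 ≤ n) (he : Even n) {X : Type*}
    {μ : RightAction (BrauerMonoid n) X} (hμ : μ.IsFaithful) :
    ((3 * numProjections n 4 + 2 * numProjections n 2 + numProjections n 0 + 1 : ℕ) : ℕ∞)
      ≤ ENat.card X := by
  obtain ⟨x₀, x₂, x₄, h₀, h₂, h₄⟩ := exists_witnesses_even h4 he hμ
  obtain ⟨c0, c2, c4, d02, d04, d24, hU⟩ := projectionOrbits_even h4 he μ x₀ x₂ x₄ h₀ h₂ h₄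
  have f0 := finite_projectionOrbit μ x₀ ⊥ 0
  have f2 := finite_projectionOrbit μ x₂ (cyclic2 h4) 2
  have f4 := finite_projectionOrbit μ x₄ (cyclic3 h4) 4
  have h := Set.ncard_add_one_le_card ((f0.union f2).union f4) hU
  rw [Set.ncard_union_eq (Set.disjoint_union_left.2 ⟨d04, d24⟩) (f0.union f2) f4,
    Set.ncard_union_eq d02 f0 f2, c0, c2, c4] at h
  convert h using 2
  ring

theorem le_card_odd (h3 : 3 ≤ n) (ho : Odd n) {X : Type*}
    {μ : RightAction (BrauerMonoid n) X} (hμ : μ.IsFaithful) :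
    ((3 * numProjections n 3 + numProjections n 1 + 1 : ℕ) : ℕ∞) ≤ ENat.card X := by
  obtain ⟨A, hA, hA'⟩ := exists_stdUpper_one_stdLower_one ho
  have he1 : Even (n - 1) := Nat.Odd.sub_odd ho odd_one
  have t3 := isTestPair_three h3 ho hA hA'
  set B := perm (threeCycle h3)⁻¹ * A with hB
  set s : Equiv.Perm (Fin n ⊕ Fin n) :=
    Equiv.swap (Sum.inr ⟨0, by omega⟩) (Sum.inr ⟨1, by omega⟩) with hs
  have s1 : ∀ i, s (Sum.inl i) = Sum.inl i := fun i =>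
    Equiv.swap_apply_of_ne_of_ne (by simp) (by simp)
  have s2 : ∀ i : Fin n, 2 ≤ i.val → s (Sum.inr i) = Sum.inr i := fun i hi =>
    Equiv.swap_apply_of_ne_of_ne (by simp [Fin.ext_iff]; omega) (by simp [Fin.ext_iff]; omega)
  have hA12 : A.1.Rel (Sum.inl ⟨1, by omega⟩) (Sum.inl ⟨2, by omega⟩) :=
    hA _ _ (by simp) (by simp) (by simp)
  have hA00 := rel_zero_of_stdUpper_one (by omega) he1 hA hA'
  -- The pair for rank one consists of `A` and its copy `D` whose transversal ends at the lower
  -- vertex `1` instead of `0`; the same `A` serves in the rank-three test pair.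
  set D : BrauerMonoid n := relabel s A with hD
  have hDu : StdUpper 1 D := fun i j hi hj e => by
    rw [hD, relabel_rel, s1, s1]
    exact hA i j hi hj e
  have hDl : StdLower 3 D := fun i j hi hj e => by
    rw [hD, relabel_rel, s2 i (by omega), s2 j (by omega)]
    exact hA' i j (by omega) (by omega) (by omega)
  have hD01 : D.1.Rel (Sum.inl ⟨0, by omega⟩) (Sum.inr ⟨1, by omega⟩) := by
    rw [hD, relabel_rel, s1, hs, Equiv.swap_apply_right]
    exact hA00
  have hAD : A ≠ D := by
    intro e
    rw [← e] at hD01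
    have := A.2.rel_unique (by simp) (by simp) hA00 hD01
    simp at this
  have hAB : A ≠ B := by
    intro e
    have h1 : B.1.Rel (Sum.inl (threeCycle h3 ⟨1, by omega⟩))
        (Sum.inl (threeCycle h3 ⟨2, by omega⟩)) := by
      rw [hB, perm_mul_rel]
      simpa using hA12
    rw [← e, show threeCycle h3 ⟨1, by omega⟩ = ⟨2, by omega⟩ from
      Fin.ext (by rw [threeCycle_val]; simp), show threeCycle h3 ⟨2, by omega⟩ = ⟨0, by omega⟩ from
      Fin.ext (by rw [threeCycle_val]; simp)] at h1
    have := A.2.rel_unique (by simp) (by simp) hA00 h1.symm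
    simp at this
  obtain ⟨x₁, h₁⟩ := exists_witnesses hμ hAD
  obtain ⟨x₃, h₃⟩ := exists_witnesses hμ hAB
  have c1 : (μ.projectionOrbit x₁ ⊥ 1).ncard = numProjections n 1 := by
    refine ncard_projectionOrbit_bot fun σ τ hσ hτ e => ?_
    by_contra hne
    exact h₁ (act_eq_of_rank_one h3 ho hA hA' hDu hDl hD01 hσ hτ hne e)
  have c3 := t3.ncard_projectionOrbit h₃
  rw [orderOf_threeCycle] at c3
  have d13 := t3.disjoint_projectionOrbit h₃ (l := 1) (C := ⊥) (by omega) (by decide)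
    (fun ξ hξ i _ => by rw [Subgroup.mem_bot.1 hξ]; rfl) x₁
  have hU : μ.projectionOrbit x₁ ⊥ 1 ∪
      μ.projectionOrbit x₃ (Subgroup.zpowers (threeCycle h3)) 3 ≠ Set.univ := by
    intro hU
    obtain ⟨y, hy⟩ := t3.exists_act_notMem h₃ he1 le_rfl hA hA' x₁
    have h1 : μ.act y A ∈ (Set.univ : Set X) := trivial
    rw [← hU] at h1
    rcases h1 with h1 | h1
    · exact hy h1
    · exact t3.act_notMem h₃ (l := 1) (by omega) (by decide) hA y h1
  have f1 := finite_projectionOrbit μ x₁ ⊥ 1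
  have f3 := finite_projectionOrbit μ x₃ (Subgroup.zpowers (threeCycle h3)) 3
  have h := Set.ncard_add_one_le_card (f1.union f3) hU
  rw [Set.ncard_union_eq d13 f1 f3, c1, c3] at h
  convert h using 2
  ring

end BrauerMonoid

/-! ### The lower bounds for even and odd degree -/

theorem proposition6p13 (n : ℕ) :
    (∀ (h4 : 4 ≤ n) (he : Even n),
      3 * BrauerMonoid.numProjections n 4 + 2 * BrauerMonoid.numProjections n 2
          + BrauerMonoid.numProjections n 0 + 1 ≤ transformationDegree (BrauerMonoid n) ∧
      ∀ (X : Type*) (μ : RightAction (BrauerMonoid n) X),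
        (μ.IsFaithful →
          ((3 * BrauerMonoid.numProjections n 4 + 2 * BrauerMonoid.numProjections n 2
            + BrauerMonoid.numProjections n 0 + 1 : ℕ) : ℕ∞) ≤ ENat.card X ∧
          ∃ x₀ x₂ x₄ : X,
            μ.Witnesses x₀ (BrauerMonoid.zeta h4 he) (BrauerMonoid.beta h4 he) ∧
            μ.Witnesses x₂ (BrauerMonoid.gamma h4 he) (BrauerMonoid.delta h4 he) ∧
            μ.Witnesses x₄ (BrauerMonoid.zeta h4 he) (BrauerMonoid.alpha h4 he)) ∧
        ∀ x₀ x₂ x₄ : X,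
          μ.Witnesses x₀ (BrauerMonoid.zeta h4 he) (BrauerMonoid.beta h4 he) →
          μ.Witnesses x₂ (BrauerMonoid.gamma h4 he) (BrauerMonoid.delta h4 he) →
          μ.Witnesses x₄ (BrauerMonoid.zeta h4 he) (BrauerMonoid.alpha h4 he) →
          (μ.projectionOrbit x₀ ⊥ 0).ncard = BrauerMonoid.numProjections n 0 ∧
          (μ.projectionOrbit x₂ (BrauerMonoid.cyclic2 h4) 2).ncard
            = 2 * BrauerMonoid.numProjections n 2 ∧
          (μ.projectionOrbit x₄ (BrauerMonoid.cyclic3 h4) 4).ncard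
            = 3 * BrauerMonoid.numProjections n 4 ∧
          Disjoint (μ.projectionOrbit x₀ ⊥ 0)
            (μ.projectionOrbit x₂ (BrauerMonoid.cyclic2 h4) 2) ∧
          Disjoint (μ.projectionOrbit x₀ ⊥ 0)
            (μ.projectionOrbit x₄ (BrauerMonoid.cyclic3 h4) 4) ∧
          Disjoint (μ.projectionOrbit x₂ (BrauerMonoid.cyclic2 h4) 2)
            (μ.projectionOrbit x₄ (BrauerMonoid.cyclic3 h4) 4) ∧
          μ.projectionOrbit x₀ ⊥ 0 ∪ μ.projectionOrbit x₂ (BrauerMonoid.cyclic2 h4) 2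
            ∪ μ.projectionOrbit x₄ (BrauerMonoid.cyclic3 h4) 4 ≠ Set.univ) ∧
    (3 ≤ n → Odd n →
      3 * BrauerMonoid.numProjections n 3 + BrauerMonoid.numProjections n 1 + 1
        ≤ transformationDegree (BrauerMonoid n) ∧
      ∀ (X : Type*) (μ : RightAction (BrauerMonoid n) X), μ.IsFaithful →
        ((3 * BrauerMonoid.numProjections n 3 + BrauerMonoid.numProjections n 1 + 1 : ℕ) : ℕ∞)
          ≤ ENat.card X) := by

  refine ⟨fun h4 he => ⟨?_, fun X μ => ⟨fun hμ => ⟨BrauerMonoid.le_card_even h4 he hμ,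
    BrauerMonoid.exists_witnesses_even h4 he hμ⟩, BrauerMonoid.projectionOrbits_even h4 he μ⟩⟩,
    fun h3 ho => ⟨?_, fun X μ hμ => BrauerMonoid.le_card_odd h3 ho hμ⟩⟩
  · refine le_transformationDegree fun m μ hμ => ?_
    simpa only [ENat.card_eq_coe_fintype_card, Fintype.card_fin, Nat.cast_le] using
      BrauerMonoid.le_card_even h4 he hμ
  · refine le_transformationDegree fun m μ hμ => ?_
    simpa only [ENat.card_eq_coe_fintype_card, Fintype.card_fin, Nat.cast_le] using
      BrauerMonoid.le_card_odd h3 ho hμ
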